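/- Let $K$ be an algebraically closed field and let $d\ge 2$, $N,M\ge 0$ be integers. A degree $d$ endomorphism of $\mathbb{P}^N$ is a map $f=[f_0,\dots,f_N]$ given by homogeneous polynomials $f_i\in K[x_0,\dots,x_N]$ of degree $d$ with no common zero other than the origin; $f^n$ denotes its $n$-th iterate. For a fixed point $P$ of $f^n$ let $\gamma_{f^n,P}(t)$ be the characteristic polynomial of the map that $f^n$ induces on the tangent space at $P$ (equivalently, of the Jacobian matrix at $P$ of a dehomogenization of $f^n$). For $n\ge1$ put $$\Sigma_n(f)=\prod_{P\in\mathrm{Fix}(f^n)}\bigl(w-\gamma_{f^n,P}(t)\bigr)=\sum_{i,j}(-1)^{i+j}\sigma^{(n)}_{i,j}(f)\,w^{D_n-i}t^{Ni-j},$$ where fixed points are counted with multiplicity (the dimension over $K$ of the local ring of the fixed point scheme of $f^n$ at $P$) and $D_n=\sum_{k=0}^N d^{nk}$ is their number. Let $\tau_{d,n}^N(f)=(\boldsymbol\sigma^{(1)}(f),\dots,\boldsymbol\sigma^{(n)}(f))$, where $\boldsymbol\sigma^{(k)}(f)$ is the collection of all the $\sigma^{(k)}_{i,j}(f)$. A family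 of degree $d$ endomorphisms of $\mathbb{P}^N$ is called isospectral if, for every $n\ge1$, $\tau_{d,n}^N$ takes the same value on all its members. Theorem. Let $(f_a)_{a\in A}$ be an isospectral family of degree $d$ endomorphisms of $\mathbb{P}^N$ and $(g_b)_{b\in B}$ an isospectral family of degree $d$ endomorphisms of $\mathbb{P}^M$, each member given by a tuple of polynomials as above. Then the family, indexed by $(a,b)\in A\times B$, of the degree $d$ endomorphisms $$h_{a,b}=f_a\times g_b=[\,f_{a,0}(x),\dots,f_{a,N}(x),\,g_{b,0}(y),\dots,g_{b,M}(y)\,]$$ of $\mathbb{P}^{N+M+1}$ with homogeneous coordinates $(x,y)=(x_0,\dots,x_N,y_0,\dots,y_M)$ is isospectral. -/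

import Mathlib

open scoped LinearAlgebra.Projectivization

noncomputable section

/-- A degree `d` endomorphism of the projective space over `K` with homogeneous coordinates indexed
by the finite type `ι` (so of dimension `Fintype.card ι - 1`; it is `ℙ^N` for `ι = Fin (N + 1)`),
given by a tuple of homogeneous polynomials of degree `d` with no common nontrivial zero.
The field `K` is algebraically closed wherever this is used. -/
structure ProjEndo (K : Type*) [Field K] (ι : Type*) (d : ℕ) where
  /-- the coordinate polynomials -/
  poly : ι → MvPolynomial ι K
  homogeneous : ∀ i, (poly i).IsHomogeneous d
  no_common_zero : ∀ v : ι → K, (∀ i, MvPolynomial.eval v (poly i) = 0) → v = 0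

namespace ProjEndo

variable {K : Type*} [Field K] {ι κ : Type*} {d : ℕ}

/-- The self-map of projective space induced by the tuple of polynomials; by homogeneity it does not
depend on the representative. -/
def map (f : ProjEndo K ι d) (P : ℙ K (ι → K)) : ℙ K (ι → K) :=
  Projectivization.mk K (fun i => MvPolynomial.eval P.rep (f.poly i))
    (fun h => P.rep_nonzero (f.no_common_zero P.rep (fun i => congrFun h i)))

/-- The coordinate polynomials of the `n`-th iterate, `f^0 = id` and `f^(n+1) = f ∘ f^n`. -/
def iterPoly (f : ProjEndo K ι d) : ℕ → ι → MvPolynomial ι K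
  | 0 => MvPolynomial.X
  | n + 1 => fun i => MvPolynomial.bind₁ (iterPoly f n) (f.poly i)

theorem iterPoly_homogeneous (f : ProjEndo K ι d) (n : ℕ) (i : ι) :
    (f.iterPoly n i).IsHomogeneous (d ^ n) := by
  induction n generalizing i with
  | zero => simpa [iterPoly] using MvPolynomial.isHomogeneous_X K i
  | succ n ih =>
    have h := (f.homogeneous i).aeval (f.iterPoly n) ih
    rw [pow_succ]
    exact h

theorem iterPoly_no_common_zero (f : ProjEndo K ι d) (n : ℕ) (v : ι → K)
    (h : ∀ i, MvPolynomial.eval v (f.iterPoly n i) = 0) : v = 0 := by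
  induction n with
  | zero => funext i; simpa [iterPoly] using h i
  | succ n ih =>
    refine ih (fun i => congrFun (f.no_common_zero
      (fun j => MvPolynomial.eval v (f.iterPoly n j)) (fun j => ?_)) i)
    have hj := h j
    simp only [iterPoly] at hj
    rwa [← MvPolynomial.coe_aeval_eq_eval, RingHom.coe_coe, MvPolynomial.aeval_bind₁,
      MvPolynomial.aeval_eq_eval] at hj

/-- The `n`-th iterate `f^n`, an endomorphism of degree `d ^ n`. -/
def iter (f : ProjEndo K ι d) (n : ℕ) : ProjEndo K ι (d ^ n) where
  poly := f.iterPoly n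
  homogeneous := f.iterPoly_homogeneous n
  no_common_zero := f.iterPoly_no_common_zero n

/-- The index of some nonzero homogeneous coordinate of `P`; we dehomogenize there. -/
def chart (P : ℙ K (ι → K)) : ι :=
  Classical.choose (Function.ne_iff.mp P.rep_nonzero)

/-- The homogeneous coordinates of `P` normalized so that the coordinate `chart P` is `1`. -/
def coords (P : ℙ K (ι → K)) : ι → K :=
  fun i => P.rep i / P.rep (chart P)

/-- The Jacobian matrix at `v` (with `v b = 1`) of the dehomogenization `φ_i = f_i / f_b`, `i ≠ b`, of
`f` in the affine chart `x_b = 1`. -/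
def jacobian (f : ProjEndo K ι d) (b : ι) (v : ι → K) : Matrix {i // i ≠ b} {i // i ≠ b} K :=
  Matrix.of fun i j =>
    (MvPolynomial.eval v (MvPolynomial.pderiv j.1 (f.poly i.1)) * MvPolynomial.eval v (f.poly b)
      - MvPolynomial.eval v (MvPolynomial.pderiv j.1 (f.poly b)) * MvPolynomial.eval v (f.poly i.1))
      / MvPolynomial.eval v (f.poly b) ^ 2

/-- The multiplier polynomial `γ_{f,P}`: the characteristic polynomial of the multiplier matrix
`df_P`, for `P` a fixed point of `f`. -/
def multiplierPoly [Fintype ι] [DecidableEq ι] (f : ProjEndo K ι d) (P : ℙ K (ι → K)) :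
    Polynomial K :=
  (f.jacobian (chart P) (coords P)).charpoly

/-- The ideal of the fixed point scheme of `f` in the affine chart `x_b = 1`: the equations
`φ_i = x_i`, that is, `f_i = x_i f_b`. -/
def fixedIdeal (f : ProjEndo K ι d) (b : ι) : Ideal (MvPolynomial ι K) :=
  Ideal.span (Set.range fun i => f.poly i - MvPolynomial.X i * f.poly b)
    ⊔ Ideal.span {MvPolynomial.X b - 1}

/-- The maximal ideal of the point `v` of affine space. -/
def pointIdeal (v : ι → K) : Ideal (MvPolynomial ι K) :=
  RingHom.ker (MvPolynomial.eval v)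

instance (v : ι → K) : (pointIdeal v).IsPrime :=
  RingHom.ker_isPrime (MvPolynomial.eval v)

/-- The multiplicity of `P` as a fixed point of `f`: the dimension over `K` of the local ring at `P`
of the fixed point scheme of `f`. -/
def fixedMult (f : ProjEndo K ι d) (P : ℙ K (ι → K)) : ℕ :=
  Module.finrank K
    (Localization.AtPrime (pointIdeal (coords P)) ⧸
      (f.fixedIdeal (chart P)).map
        (algebraMap (MvPolynomial ι K) (Localization.AtPrime (pointIdeal (coords P)))))

/-- `Σ_n(f) = ∏ (w - γ_{f^n,P}(t))` in `K[t][w]`, the product over the fixed points `P` of `f^n`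
counted with multiplicity. (There are finitely many of them when `d ≥ 2` and `n ≥ 1`.) -/
def sigmaPoly [Fintype ι] [DecidableEq ι] (f : ProjEndo K ι d) (n : ℕ) :
    Polynomial (Polynomial K) :=
  ∏ᶠ P ∈ Function.fixedPoints (f.iter n).map,
    (Polynomial.X - Polynomial.C ((f.iter n).multiplierPoly P)) ^ (f.iter n).fixedMult P

/-- The number `D_n = 1 + d^n + ⋯ + d^(nN)` of fixed points of the `n`-th iterate of a degree `d`
endomorphism, counted with multiplicity, where `N + 1` is the number of coordinates. -/
def numPer (ι : Type*) [Fintype ι] (d n : ℕ) : ℕ :=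
  ∑ k ∈ Finset.range (Fintype.card ι), d ^ (n * k)

/-- The multiplier invariants `σ^{(n)}_{i,j}`, defined by
`Σ_n(f) = ∑_{i,j} (-1)^(i+j) σ^{(n)}_{i,j} w^(D_n - i) t^(N i - j)` with `N + 1` the number of
coordinates. The labels run through all integers, so that every coefficient of `Σ_n(f)` has one. -/
def sigma [Fintype ι] [DecidableEq ι] (f : ProjEndo K ι d) (n : ℕ) (i j : ℤ) : K :=
  if 0 ≤ (numPer ι d n : ℤ) - i ∧ 0 ≤ ((Fintype.card ι : ℤ) - 1) * i - j then
    (-1) ^ (i + j) * ((f.sigmaPoly n).coeff ((numPer ι d n : ℤ) - i).toNat).coeff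
      (((Fintype.card ι : ℤ) - 1) * i - j).toNat
  else 0

/-- The multiplier map `τ_{d,n}(f) = (σ^{(1)}, …, σ^{(n)})`. -/
def tau [Fintype ι] [DecidableEq ι] (f : ProjEndo K ι d) (n : ℕ) : Fin n → ℤ → ℤ → K :=
  fun k => f.sigma (k.1 + 1)

/-- A family of endomorphisms is isospectral if `τ_{d,n}` is constant on it for every `n`. -/
def IsIsospectral [Fintype ι] [DecidableEq ι] {A : Type*} (f : A → ProjEndo K ι d) : Prop :=
  ∀ n : ℕ, ∀ a a' : A, (f a).tau n = (f a').tau n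

/-- The cartesian product `f × g = [f_0(x), …, f_N(x), g_0(y), …, g_M(y)]`, on the projective space
with coordinates `(x, y)`. -/
def prod (f : ProjEndo K ι d) (g : ProjEndo K κ d) : ProjEndo K (ι ⊕ κ) d where
  poly := Sum.elim (fun i => MvPolynomial.rename Sum.inl (f.poly i))
    (fun j => MvPolynomial.rename Sum.inr (g.poly j))
  homogeneous := by
    rintro (i | j)
    · exact (f.homogeneous i).rename_isHomogeneous
    · exact (g.homogeneous j).rename_isHomogeneous
  no_common_zero := by
    intro v h
    have h1 := f.no_common_zero (v ∘ Sum.inl) (fun i => by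
      simpa [MvPolynomial.eval_rename] using h (Sum.inl i))
    have h2 := g.no_common_zero (v ∘ Sum.inr) (fun j => by
      simpa [MvPolynomial.eval_rename] using h (Sum.inr j))
    funext k
    rcases k with i | j
    · exact congrFun h1 i
    · exact congrFun h2 j

end ProjEndo

end

/-! The product map on projective space is not a product of the two projective maps, but on affine
cones it is: the cone map of `f × g` on `(x, y)`-space is the product of the two cone maps. The
proof therefore passes from fixed points of `F = f^n`, of degree `D = d^n ≥ 2`, to fixed vectors
`F(v) = v` of its cone map.

These fixed vectors are the origin and the suitable rescalings of the fixed points `P` of `F`. At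
the origin the Jacobian vanishes and the multiplicity is 1 (`localMult_affIdeal_zero`). If `u`
represents `P` with `u_b = 1`, the vectors over `P` are the `s u` with `s^(D-1) F_b(u) = 1`.
Scheme-theoretically this equation defines a free extension of rank `D - 1`, so the multiplicities
over `P` add up to `D - 1` times that of `P`, even if the characteristic divides `D - 1`
(`finrank_eq_mul_of_scaling`, `sum_localMult_affIdeal`). By Euler's identity `v` is an eigenvector
of the Jacobian at `v` with eigenvalue `D`, and the quotient by this direction gives the multiplier
at `P`; the characteristic polynomial is `(t - D) γ_P(t)` (`charpoly_coneJacobian`).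

Collecting characteristic polynomials with multiplicity as formal sums over `ℕ` on the
multiplicative monoid `K[t]`, this reads `coneSpectrum = [t^(N+1)] + (D - 1) [t - D] * spectrum`
(`coneSpectrum_eq`). Since `[t - D]` and `D - 1` can be cancelled, the two spectra determine each
other (`coneSpectrum_eq_iff`). The cone spectrum is multiplicative in products
(`coneSpectrum_prod`), and the spectrum carries the same information as `Σ_n`, being its multiset of
roots in `w` (`sigmaPoly_eq_iff`). -/

open MvPolynomial
open scoped LinearAlgebra.Projectivization TensorProduct

noncomputable section

variable {K : Type*} [Field K] {ι κ : Type*}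

/-! ### Local rings and multiplicities on affine schemes. -/

/-- The local ring at `v` of the affine scheme defined by `I`. -/
def LocalRingAt (I : Ideal (MvPolynomial ι K)) (v : ι → K) : Type _ :=
  Localization.AtPrime (ProjEndo.pointIdeal v) ⧸
    I.map (algebraMap (MvPolynomial ι K) (Localization.AtPrime (ProjEndo.pointIdeal v)))

namespace LocalRingAt

instance (I : Ideal (MvPolynomial ι K)) (v : ι → K) : CommRing (LocalRingAt I v) :=
  inferInstanceAs (CommRing (Localization.AtPrime (ProjEndo.pointIdeal v) ⧸
    I.map (algebraMap (MvPolynomial ι K) (Localization.AtPrime (ProjEndo.pointIdeal v)))))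

instance (I : Ideal (MvPolynomial ι K)) (v : ι → K) : Algebra K (LocalRingAt I v) :=
  inferInstanceAs (Algebra K (Localization.AtPrime (ProjEndo.pointIdeal v) ⧸
    I.map (algebraMap (MvPolynomial ι K) (Localization.AtPrime (ProjEndo.pointIdeal v)))))

/-- The projection from the local ring of affine space at `v`. -/
def mk (I : Ideal (MvPolynomial ι K)) (v : ι → K) :
    Localization.AtPrime (ProjEndo.pointIdeal v) →ₐ[K] LocalRingAt I v :=
  Ideal.Quotient.mkₐ K _

theorem mk_surjective (I : Ideal (MvPolynomial ι K)) (v : ι → K) :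
    Function.Surjective (mk I v) := Ideal.Quotient.mk_surjective

theorem mk_eq_zero_iff {I : Ideal (MvPolynomial ι K)} {v : ι → K}
    {x : Localization.AtPrime (ProjEndo.pointIdeal v)} :
    mk I v x = 0 ↔ x ∈ I.map (algebraMap (MvPolynomial ι K) _) :=
  Ideal.Quotient.eq_zero_iff_mem

theorem mk_eq_mk_iff {I : Ideal (MvPolynomial ι K)} {v : ι → K}
    {x y : Localization.AtPrime (ProjEndo.pointIdeal v)} :
    mk I v x = mk I v y ↔ x - y ∈ I.map (algebraMap (MvPolynomial ι K) _) := by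
  rw [← mk_eq_zero_iff, map_sub, sub_eq_zero]

end LocalRingAt

/-- The dimension over `K` of the local ring at `v` of the affine scheme defined by `I`. -/
def localMult (I : Ideal (MvPolynomial ι K)) (v : ι → K) : ℕ :=
  Module.finrank K (LocalRingAt I v)

theorem ProjEndo.fixedMult_eq_localMult {d : ℕ} (f : ProjEndo K ι d) (P : ℙ K (ι → K)) :
    f.fixedMult P = localMult (f.fixedIdeal (chart P)) (coords P) := rfl

theorem mem_pointIdeal {v : ι → K} {p : MvPolynomial ι K} :
    p ∈ ProjEndo.pointIdeal v ↔ eval v p = 0 := Iff.rfl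

/-! ### Finite affine schemes: Nullstellensatz, idempotents, decomposition into local rings. -/

theorem mem_zeroLocus_iff_eval {I : Ideal (MvPolynomial ι K)} {v : ι → K} :
    v ∈ zeroLocus K I ↔ ∀ p ∈ I, eval v p = 0 := by
  simp [mem_zeroLocus_iff, aeval_eq_eval]

theorem zeroLocus_sup_eq (I J : Ideal (MvPolynomial ι K)) :
    zeroLocus K (I ⊔ J) = zeroLocus K I ∩ zeroLocus K J := by
  refine Set.Subset.antisymm (Set.subset_inter (zeroLocus_anti_mono le_sup_left)
    (zeroLocus_anti_mono le_sup_right)) ?_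
  rintro v ⟨h1, h2⟩ p hp
  obtain ⟨a, ha, b, hb, rfl⟩ := Submodule.mem_sup.mp hp
  rw [map_add, h1 a ha, h2 b hb, add_zero]

theorem mem_zeroLocus_span_iff_eval {s : Set (MvPolynomial ι K)} {v : ι → K} :
    v ∈ zeroLocus K (Ideal.span s) ↔ ∀ p ∈ s, eval v p = 0 := by
  simp [zeroLocus_span, aeval_eq_eval]

/-- A nonunit lies in a maximal ideal, whose residue field is finite over the algebraically closed
`K` and hence maps to `K`. -/
theorem isUnit_of_forall_algHom_ne_zero [IsAlgClosed K] {A : Type*} [CommRing A] [Algebra K A]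
    [Module.Finite K A] {a : A} (h : ∀ ψ : A →ₐ[K] K, ψ a ≠ 0) : IsUnit a := by
  by_contra ha
  obtain ⟨m, hm, ham⟩ := exists_max_ideal_of_mem_nonunits ha
  let ψ : A ⧸ m →ₐ[K] K := IsAlgClosed.lift
  refine h (ψ.comp (Ideal.Quotient.mkₐ K m)) ?_
  simp [Ideal.Quotient.eq_zero_iff_mem.mpr ham]

theorem eq_top_of_zeroLocus_eq_empty [IsAlgClosed K] [Finite ι] {I : Ideal (MvPolynomial ι K)}
    (h : zeroLocus K I = ∅) : I = ⊤ := by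
  rw [← Ideal.radical_eq_top, ← vanishingIdeal_zeroLocus_eq_radical (K := K), h,
    vanishingIdeal_empty]

/-- A polynomial without zeros on the zero locus of `I` is invertible modulo `I`. -/
theorem isUnit_mk_of_forall_eval_ne_zero [IsAlgClosed K] [Finite ι] {I : Ideal (MvPolynomial ι K)}
    {p : MvPolynomial ι K} (h : ∀ v ∈ zeroLocus K I, eval v p ≠ 0) :
    IsUnit (Ideal.Quotient.mk I p) := by
  have htop : I ⊔ Ideal.span {p} = ⊤ := by
    apply eq_top_of_zeroLocus_eq_empty
    rw [zeroLocus_sup_eq, Set.eq_empty_iff_forall_notMem]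
    rintro v ⟨h1, h2⟩
    exact h v h1 (mem_zeroLocus_span_iff_eval.mp h2 p rfl)
  obtain ⟨a, ha, b, hb, hab⟩ := Submodule.mem_sup.mp ((Ideal.eq_top_iff_one _).mp htop)
  obtain ⟨c, rfl⟩ := Ideal.mem_span_singleton.mp hb
  refine IsUnit.of_mul_eq_one (Ideal.Quotient.mk I c) ?_
  rw [← map_mul, ← map_one (Ideal.Quotient.mk I), ← hab, map_add,
    Ideal.Quotient.eq_zero_iff_mem.mpr ha, zero_add]

/-- The product of the `X i - v i` over the zeros `v` vanishes on the zero locus, so a power of it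
lies in `I`. Each coordinate is thus integral modulo `I`, and a finitely generated integral algebra
is finite. -/
theorem finite_quotient_of_finite_zeroLocus [IsAlgClosed K] [Finite ι] {I : Ideal (MvPolynomial ι K)}
    (h : (zeroLocus K I).Finite) : Module.Finite K (MvPolynomial ι K ⧸ I) := by
  have hX (i : ι) : IsIntegral K (Ideal.Quotient.mk I (X i)) := by
    have hmem : (∏ v ∈ h.toFinset, (X i - C (v i)) : MvPolynomial ι K) ∈ I.radical := by
      rw [← vanishingIdeal_zeroLocus_eq_radical (K := K)]
      intro v hv
      rw [map_prod]
      exact Finset.prod_eq_zero (h.mem_toFinset.mpr hv) (by simp)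
    obtain ⟨k, hk⟩ := hmem
    refine ⟨(∏ v ∈ h.toFinset, (Polynomial.X - Polynomial.C (v i))) ^ k,
      (Polynomial.monic_prod_of_monic _ _ fun v _ => Polynomial.monic_X_sub_C _).pow k, ?_⟩
    rw [← Ideal.Quotient.eq_zero_iff_mem] at hk
    rw [← hk]
    simp only [Polynomial.eval₂_pow, Polynomial.eval₂_finsetProd, Polynomial.eval₂_sub,
      Polynomial.eval₂_X, Polynomial.eval₂_C, map_pow, map_prod, map_sub]
    rfl
  have : Algebra.IsIntegral K (MvPolynomial ι K ⧸ I) := by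
    refine ⟨fun q => ?_⟩
    obtain ⟨p, rfl⟩ := Ideal.Quotient.mk_surjective q
    induction p using MvPolynomial.induction_on with
    | C a => exact isIntegral_algebraMap (x := a)
    | add p q hp hq => rw [map_add]; exact hp.add hq
    | mul_X p i hp => rw [map_mul]; exact hp.mul (hX i)
  exact Algebra.IsIntegral.finite

/-- Ideals of distinct points are coprime, so the Chinese remainder theorem interpolates the
indicator function. -/
theorem exists_eval_eq_indicator {V : Set (ι → K)} (hV : V.Finite) (T : Set (ι → K)) :
    ∃ p : MvPolynomial ι K, ∀ v ∈ V, (v ∈ T → eval v p = 1) ∧ (v ∉ T → eval v p = 0) := by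
  classical
  have : Finite V := hV
  have hco : Pairwise (Function.onFun IsCoprime fun v : V => ProjEndo.pointIdeal v.1) := by
    intro v w hvw
    obtain ⟨i, hi⟩ := Function.ne_iff.mp (Subtype.coe_injective.ne hvw)
    rw [Function.onFun, Ideal.isCoprime_iff_exists]
    refine ⟨C (w.1 i - v.1 i)⁻¹ * (X i - C (v.1 i)), by simp [mem_pointIdeal],
      C (w.1 i - v.1 i)⁻¹ * (C (w.1 i) - X i), by simp [mem_pointIdeal], ?_⟩
    rw [← mul_add, sub_add_sub_cancel', ← C_sub, ← C_mul, inv_mul_cancel₀ (sub_ne_zero.mpr hi.symm),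
      C_1]
  obtain ⟨p, hp⟩ := Ideal.exists_forall_sub_mem_ideal hco (fun v => if v.1 ∈ T then 1 else 0)
  refine ⟨p, fun v hv => ?_⟩
  have := hp ⟨v, hv⟩
  rw [mem_pointIdeal, map_sub, sub_eq_zero] at this
  constructor <;> intro h <;> simpa [h] using this

/-- Idempotents modulo `I` realizing the indicator function of a subset of a finite zero locus. -/
theorem exists_idempotent [IsAlgClosed K] [Finite ι] {I : Ideal (MvPolynomial ι K)}
    (h : (zeroLocus K I).Finite) (T : Set (ι → K)) :
    ∃ e : MvPolynomial ι K, e * (1 - e) ∈ I ∧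
      ∀ v ∈ zeroLocus K I, (v ∈ T → eval v e = 1) ∧ (v ∉ T → eval v e = 0) := by
  obtain ⟨p, hp⟩ := exists_eval_eq_indicator h T
  have hle : I ≤ I.radical := Ideal.le_radical
  -- The interpolating polynomial is idempotent modulo the radical; idempotents lift along the nil
  -- kernel of the quotient map to the quotient by the radical.
  obtain ⟨e', he', hpe⟩ := exists_isIdempotentElem_eq_of_ker_isNilpotent
    (Ideal.Quotient.factor hle) (by
      intro x hx
      obtain ⟨q, rfl⟩ := Ideal.Quotient.mk_surjective x
      rw [RingHom.mem_ker, Ideal.Quotient.factor_mk, Ideal.Quotient.eq_zero_iff_mem] at hx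
      obtain ⟨k, hk⟩ := hx
      exact ⟨k, by rw [← map_pow, Ideal.Quotient.eq_zero_iff_mem]; exact hk⟩)
    (Ideal.Quotient.mk _ p) ⟨Ideal.Quotient.mk _ p, Ideal.Quotient.factor_mk _ _⟩ (by
      rw [IsIdempotentElem, ← map_mul, Ideal.Quotient.mk_eq_mk_iff_sub_mem,
        ← vanishingIdeal_zeroLocus_eq_radical (K := K)]
      intro v hv
      by_cases hT : v ∈ T
      · simp [aeval_eq_eval, (hp v hv).1 hT]
      · simp [aeval_eq_eval, (hp v hv).2 hT])
  obtain ⟨e, rfl⟩ := Ideal.Quotient.mk_surjective e'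
  refine ⟨e, ?_, fun v hv => ?_⟩
  · rw [IsIdempotentElem, ← map_mul, Ideal.Quotient.mk_eq_mk_iff_sub_mem] at he'
    rw [show e * (1 - e) = -(e * e - e) by ring]
    exact I.neg_mem he'
  · rw [Ideal.Quotient.factor_mk, Ideal.Quotient.mk_eq_mk_iff_sub_mem,
      ← vanishingIdeal_zeroLocus_eq_radical (K := K)] at hpe
    have := hpe v hv
    rw [aeval_eq_eval, map_sub, sub_eq_zero] at this
    rw [this]
    exact hp v hv

theorem isUnit_algebraMap_atPrime {v : ι → K} {p : MvPolynomial ι K} (hp : eval v p ≠ 0) :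
    IsUnit (algebraMap (MvPolynomial ι K) (Localization.AtPrime (ProjEndo.pointIdeal v)) p) :=
  IsLocalization.map_units _ (⟨p, hp⟩ : (ProjEndo.pointIdeal v).primeCompl)

/-- In the local ring at `v` the element `e` is a unit and annihilates `1 - e` modulo `I`. -/
theorem one_sub_mem_map_of_idempotent {I : Ideal (MvPolynomial ι K)} {e : MvPolynomial ι K}
    (he : e * (1 - e) ∈ I) {v : ι → K} (hv : eval v e ≠ 0) :
    algebraMap (MvPolynomial ι K) (Localization.AtPrime (ProjEndo.pointIdeal v)) (1 - e) ∈
      I.map (algebraMap (MvPolynomial ι K) (Localization.AtPrime (ProjEndo.pointIdeal v))) := by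
  have := Ideal.mem_map_of_mem
    (algebraMap (MvPolynomial ι K) (Localization.AtPrime (ProjEndo.pointIdeal v))) he
  rw [map_mul] at this
  exact (Ideal.unit_mul_mem_iff_mem _ (isUnit_algebraMap_atPrime hv)).mp this

theorem localMult_eq_of_le {I J : Ideal (MvPolynomial ι K)} {v : ι → K} (h : I ≤ J)
    (hJ : J.map (algebraMap _ (Localization.AtPrime (ProjEndo.pointIdeal v))) ≤
      I.map (algebraMap _ (Localization.AtPrime (ProjEndo.pointIdeal v)))) :
    localMult J v = localMult I v :=
  congrArg (fun Q : Ideal (Localization.AtPrime (ProjEndo.pointIdeal v)) =>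
    Module.finrank K (Localization.AtPrime (ProjEndo.pointIdeal v) ⧸ Q))
    (le_antisymm hJ (Ideal.map_mono h))

/-- Adding the equation `e = 1` discards the points where `e` vanishes and leaves the local rings at
the others unchanged. -/
theorem localMult_sup_span_one_sub {I : Ideal (MvPolynomial ι K)} {e : MvPolynomial ι K}
    (he : e * (1 - e) ∈ I) {v : ι → K} (hv : eval v e ≠ 0) :
    localMult (I ⊔ Ideal.span {1 - e}) v = localMult I v := by
  refine localMult_eq_of_le le_sup_left ?_
  rw [Ideal.map_sup, Ideal.map_span, Set.image_singleton, sup_le_iff, Ideal.span_singleton_le_iff_mem]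
  exact ⟨le_rfl, one_sub_mem_map_of_idempotent he hv⟩

/-- The natural map from the coordinate ring of a finite scheme to its local ring at `v`. -/
def toLocalRing (I : Ideal (MvPolynomial ι K)) (v : ι → K) :
    (MvPolynomial ι K ⧸ I) →ₐ[K] LocalRingAt I v :=
  Ideal.Quotient.liftₐ I ((LocalRingAt.mk I v).comp (IsScalarTower.toAlgHom K _ _)) fun _ hp =>
    LocalRingAt.mk_eq_zero_iff.mpr (Ideal.mem_map_of_mem _ hp)

theorem toLocalRing_mk (I : Ideal (MvPolynomial ι K)) (v : ι → K) (p : MvPolynomial ι K) :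
    toLocalRing I v (Ideal.Quotient.mk I p) = LocalRingAt.mk I v (algebraMap _ _ p) := rfl

theorem toLocalRing_surjective [IsAlgClosed K] [Finite ι] {I : Ideal (MvPolynomial ι K)}
    (h : (zeroLocus K I).Finite) {v : ι → K} (hv : v ∈ zeroLocus K I) :
    Function.Surjective (toLocalRing I v) := by
  obtain ⟨e, he, hev⟩ := exists_idempotent h {v}
  intro y
  obtain ⟨y, rfl⟩ := LocalRingAt.mk_surjective I v y
  obtain ⟨⟨p, s⟩, rfl⟩ := IsLocalization.mk'_surjective (ProjEndo.pointIdeal v).primeCompl y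
  have hs : eval v s.1 ≠ 0 := s.2
  -- The idempotent isolates `v`, so the denominator `s` vanishes nowhere on the remaining scheme
  -- and has a polynomial inverse `t` there; `p * t` then represents `p / s`.
  have hunit : IsUnit (Ideal.Quotient.mk (I ⊔ Ideal.span {1 - e}) s.1) := by
    refine isUnit_mk_of_forall_eval_ne_zero fun w hw => ?_
    rw [zeroLocus_sup_eq] at hw
    have h1 := mem_zeroLocus_span_iff_eval.mp hw.2 _ rfl
    rw [map_sub, map_one, sub_eq_zero] at h1
    by_cases hwv : w = v
    · rwa [hwv]
    · rw [(hev w hw.1).2 hwv] at h1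
      exact absurd h1 one_ne_zero
  obtain ⟨t, ht⟩ := hunit.exists_right_inv
  obtain ⟨t, rfl⟩ := Ideal.Quotient.mk_surjective t
  refine ⟨Ideal.Quotient.mk I (p * t), ?_⟩
  rw [toLocalRing_mk, LocalRingAt.mk_eq_mk_iff]
  have hst : algebraMap _ (Localization.AtPrime (ProjEndo.pointIdeal v)) (s.1 * t - 1) ∈
      I.map (algebraMap _ (Localization.AtPrime (ProjEndo.pointIdeal v))) := by
    rw [← map_mul, ← map_one (Ideal.Quotient.mk _), Ideal.Quotient.mk_eq_mk_iff_sub_mem] at ht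
    obtain ⟨a, ha, b, hb, hab⟩ := Submodule.mem_sup.mp ht
    obtain ⟨c, rfl⟩ := Ideal.mem_span_singleton.mp hb
    rw [← hab, map_add, map_mul]
    refine Ideal.add_mem _ (Ideal.mem_map_of_mem _ ha) (Ideal.mul_mem_right _ _
      (one_sub_mem_map_of_idempotent he ?_))
    rw [(hev v hv).1 rfl]
    exact one_ne_zero
  rw [← Ideal.unit_mul_mem_iff_mem _ (isUnit_algebraMap_atPrime hs), mul_sub,
    mul_comm _ (IsLocalization.mk' _ _ _), IsLocalization.mk'_spec, ← map_mul, ← map_sub,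
    show s.1 * (p * t) - p = p * (s.1 * t - 1) by ring, map_mul]
  exact Ideal.mul_mem_left _ _ hst

theorem exists_mul_mem_of_toLocalRing_eq_zero {I : Ideal (MvPolynomial ι K)} {v : ι → K}
    {p : MvPolynomial ι K} (hp : toLocalRing I v (Ideal.Quotient.mk I p) = 0) :
    ∃ s, eval v s ≠ 0 ∧ s * p ∈ I := by
  rw [toLocalRing_mk, LocalRingAt.mk_eq_zero_iff,
    IsLocalization.algebraMap_mem_map_algebraMap_iff (ProjEndo.pointIdeal v).primeCompl] at hp
  obtain ⟨s, hs, hsp⟩ := hp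
  exact ⟨s, hs, hsp⟩

/-- The coordinate ring of a finite scheme is the product of its local rings. -/
theorem bijective_toLocalRing_pi [IsAlgClosed K] [Finite ι] {I : Ideal (MvPolynomial ι K)}
    (h : (zeroLocus K I).Finite) :
    Function.Bijective fun x (v : zeroLocus K I) => toLocalRing I v.1 x := by
  constructor
  · intro x x' hxx'
    rw [← sub_eq_zero]
    have hy (v : zeroLocus K I) : toLocalRing I v.1 (x - x') = 0 := by
      rw [map_sub, sub_eq_zero]
      exact congrFun hxx' v
    generalize x - x' = y at hy
    obtain ⟨p, rfl⟩ := Ideal.Quotient.mk_surjective y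
    rw [Ideal.Quotient.eq_zero_iff_mem]
    -- For every zero `v` of `I` the colon ideal contains some `s` with `s(v) ≠ 0`, because `p` dies
    -- in the local ring at `v`. The colon ideal thus has no zeros, and `1 * p ∈ I`.
    have htop : I.colon ({p} : Set (MvPolynomial ι K)) = ⊤ := by
      apply eq_top_of_zeroLocus_eq_empty
      rw [Set.eq_empty_iff_forall_notMem]
      intro v hv
      have hle : I ≤ I.colon ({p} : Set (MvPolynomial ι K)) := fun q hq =>
        Submodule.mem_colon_singleton.mpr (I.mul_mem_right _ hq)
      obtain ⟨s, hs, hsp⟩ := exists_mul_mem_of_toLocalRing_eq_zero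
        (hy ⟨v, zeroLocus_anti_mono hle hv⟩)
      exact hs (mem_zeroLocus_iff_eval.mp hv s (Submodule.mem_colon_singleton.mpr hsp))
    simpa using Submodule.mem_colon_singleton.mp ((Ideal.eq_top_iff_one _).mp htop)
  · intro y
    have : Fintype (zeroLocus K I) := h.fintype
    choose e he hev using fun v : zeroLocus K I => exists_idempotent h {v.1}
    choose q hq using fun v : zeroLocus K I => toLocalRing_surjective h v.2 (y v)
    -- Local preimages are glued by the idempotents: `e v` becomes 1 in the local ring at `v` and 0
    -- in the others.
    refine ⟨∑ v, Ideal.Quotient.mk I (e v) * q v, funext fun w => ?_⟩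
    beta_reduce
    rw [map_sum, Finset.sum_eq_single w]
    · rw [map_mul, hq, toLocalRing_mk]
      have := one_sub_mem_map_of_idempotent (he w) (v := w.1)
        (by rw [(hev w w w.2).1 rfl]; exact one_ne_zero)
      rw [map_sub, map_one, ← LocalRingAt.mk_eq_mk_iff, map_one] at this
      rw [← this, one_mul]
    · intro v _ hvw
      rw [map_mul, toLocalRing_mk]
      have := one_sub_mem_map_of_idempotent (e := 1 - e v) (by simpa [mul_comm] using he v) (v := w.1)
        (by rw [map_sub, map_one, (hev v w w.2).2 (fun hh => hvw (Subtype.ext hh.symm))]; simp)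
      rw [sub_sub_cancel, ← LocalRingAt.mk_eq_zero_iff] at this
      rw [this, zero_mul]
    · simp

theorem finrank_eq_sum_finrank_of_bijective {A α : Type*} {B : α → Type*} [Fintype α] [CommRing A]
    [Algebra K A] [∀ i, CommRing (B i)] [∀ i, Algebra K (B i)] [Module.Finite K A]
    (f : ∀ i, A →ₐ[K] B i) (hf : ∀ i, Function.Surjective (f i))
    (hbij : Function.Bijective fun x i => f i x) :
    Module.finrank K A = ∑ i, Module.finrank K (B i) := by
  have (i : α) := Module.Finite.of_surjective (f i).toLinearMap (hf i)
  rw [← Module.finrank_pi_fintype]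
  exact (LinearEquiv.ofBijective (LinearMap.pi fun i => (f i).toLinearMap) hbij).finrank_eq

/-- The dimension of the coordinate ring of a finite scheme is the sum of its multiplicities. -/
theorem finrank_quotient_eq_sum_localMult [IsAlgClosed K] [Finite ι] {I : Ideal (MvPolynomial ι K)}
    (h : (zeroLocus K I).Finite) :
    Module.finrank K (MvPolynomial ι K ⧸ I) = ∑ v ∈ h.toFinset, localMult I v := by
  have : Fintype (zeroLocus K I) := h.fintype
  have := finite_quotient_of_finite_zeroLocus h
  rw [Finset.sum_subtype _ (fun v => h.mem_toFinset) _]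
  exact finrank_eq_sum_finrank_of_bijective (fun v : zeroLocus K I => toLocalRing I v.1)
    (fun v => toLocalRing_surjective h v.2) (bijective_toLocalRing_pi h)

/-- The `i`-th coordinate of a zero is a root of the minimal polynomial of `X i` modulo `I`. -/
theorem finite_zeroLocus_of_finite_quotient [Finite ι] {I : Ideal (MvPolynomial ι K)}
    [Module.Finite K (MvPolynomial ι K ⧸ I)] : (zeroLocus K I).Finite := by
  refine (Set.Finite.pi fun i => (minpoly K (Ideal.Quotient.mk I (X i))).rootSet_finite K).subset
    fun v hv i _ => ?_
  let ψ : (MvPolynomial ι K ⧸ I) →ₐ[K] K := Ideal.Quotient.liftₐ I (aeval v) hv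
  have hψ : ψ (Ideal.Quotient.mk I (X i)) = v i := aeval_X v i
  rw [Polynomial.mem_rootSet]
  refine ⟨minpoly.ne_zero (Algebra.IsIntegral.isIntegral _), ?_⟩
  rw [← hψ, Polynomial.aeval_algHom_apply, minpoly.aeval, map_zero]

/-! ### Homogeneous polynomials. -/

theorem homogeneousComponent_mul_of_isHomogeneous {R : Type*} [CommSemiring R]
    {q p : MvPolynomial ι R} {d n : ℕ}
    (hp : p.IsHomogeneous d) (hn : d ≤ n) :
    homogeneousComponent n (q * p) = homogeneousComponent (n - d) q * p := by
  conv_lhs => rw [← sum_homogeneousComponent q, Finset.sum_mul, map_sum]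
  have h (i : ℕ) : homogeneousComponent n (homogeneousComponent i q * p) =
      if n - d = i then homogeneousComponent (n - d) q * p else 0 := by
    rw [homogeneousComponent_of_mem ((homogeneousComponent_isHomogeneous i q).mul hp)]
    by_cases h : n - d = i
    · rw [if_pos (by omega), if_pos h, h]
    · rw [if_neg (by omega), if_neg h]
  simp_rw [h]
  rw [Finset.sum_ite_eq]
  split_ifs with hmem
  · rfl
  · rw [homogeneousComponent_eq_zero, zero_mul]
    rw [Finset.mem_range] at hmem
    omega

theorem degree_eq_of_isHomogeneous {R : Type*} [CommSemiring R] {p : MvPolynomial ι R} {d : ℕ}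
    (hp : p.IsHomogeneous d) {m : ι →₀ ℕ} (hm : m ∈ p.support) : m.degree = d :=
  (DFunLike.congr_fun Finsupp.degree_eq_weight_one m).trans (hp (mem_support_iff.mp hm))

theorem aeval_mul_of_isHomogeneous {R A : Type*} [CommSemiring R] [CommSemiring A] [Algebra R A]
    {p : MvPolynomial ι R} {d : ℕ} (hp : p.IsHomogeneous d) (s : A) (x : ι → A) :
    aeval (fun i => s * x i) p = s ^ d * aeval x p := by
  rw [aeval_def, aeval_def, eval₂_eq, eval₂_eq, Finset.mul_sum]
  refine Finset.sum_congr rfl fun m hm => ?_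
  have hdeg : ∑ i ∈ m.support, m i = d := by
    rw [← degree_eq_of_isHomogeneous hp hm, Finsupp.degree_apply]
  simp_rw [mul_pow, Finset.prod_mul_distrib, Finset.prod_pow_eq_pow_sum, hdeg]
  ring

theorem eval_smul_of_isHomogeneous {p : MvPolynomial ι K} {d : ℕ} (hp : p.IsHomogeneous d)
    (s : K) (v : ι → K) : eval (s • v) p = s ^ d * eval v p := by
  have := aeval_mul_of_isHomogeneous hp s v
  rwa [aeval_eq_eval, aeval_eq_eval] at this

/-! ### Fixed vectors of the cone map, fixed points of the projective map, and their finiteness. -/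

namespace ProjEndo

variable {D : ℕ} (F : ProjEndo K ι D)

/-- The ideal of the fixed point scheme of the self-map of the affine cone given by `F`. -/
def affIdeal : Ideal (MvPolynomial ι K) :=
  Ideal.span (Set.range fun i => F.poly i - X i)

variable {F} in
theorem mem_zeroLocus_affIdeal {v : ι → K} :
    v ∈ zeroLocus K F.affIdeal ↔ ∀ i, eval v (F.poly i) = v i := by
  rw [affIdeal, mem_zeroLocus_span_iff_eval]
  simp [sub_eq_zero]

variable {F} in
theorem mem_zeroLocus_fixedIdeal {b : ι} {v : ι → K} :
    v ∈ zeroLocus K (F.fixedIdeal b) ↔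
      (∀ i, eval v (F.poly i) = v i * eval v (F.poly b)) ∧ v b = 1 := by
  rw [fixedIdeal, zeroLocus_sup_eq, Set.mem_inter_iff, mem_zeroLocus_span_iff_eval,
    mem_zeroLocus_span_iff_eval]
  simp [sub_eq_zero]

/-- The Nullstellensatz applied to the absence of nontrivial common zeros. -/
theorem idealOfVars_le_radical [IsAlgClosed K] [Finite ι] :
    idealOfVars ι K ≤ (Ideal.span (Set.range F.poly)).radical := by
  rw [idealOfVars, Ideal.span_le]
  rintro _ ⟨i, rfl⟩
  rw [← vanishingIdeal_zeroLocus_eq_radical (K := K)]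
  intro v hv
  have := F.no_common_zero v fun i => mem_zeroLocus_span_iff_eval.mp hv _ ⟨i, rfl⟩
  simp [this]

/-- Modulo the equations `F = x`, every polynomial is congruent to one of bounded degree. -/
theorem exists_affIdeal_sup_restrictTotalDegree [IsAlgClosed K] [Finite ι] (hD : 2 ≤ D) :
    ∃ k, F.affIdeal.restrictScalars K ⊔ restrictTotalDegree ι K k = ⊤ := by
  have := Fintype.ofFinite ι
  obtain ⟨k, hk⟩ := Ideal.exists_pow_le_of_le_radical_of_fg F.idealOfVars_le_radical
    (idealOfVars_fg ι K)
  -- Above degree `k` a form lies in the ideal of the `F_i`; the bound `D` ensures that `n - D` is a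
  -- true subtraction below.
  refine ⟨max k D, ?_⟩
  have hhom (n : ℕ) : ∀ p : MvPolynomial ι K, p.IsHomogeneous n →
      p ∈ F.affIdeal.restrictScalars K ⊔ restrictTotalDegree ι K (max k D) := by
    induction n using Nat.strong_induction_on with
    | _ n ih =>
      intro p hp
      by_cases hn : n ≤ max k D
      · exact Submodule.mem_sup_right
          ((mem_restrictTotalDegree _ _ _).mpr (hp.totalDegree_le.trans hn))
      · have hpk : p ∈ idealOfVars ι K ^ k := by
          rw [mem_pow_idealOfVars_iff]
          intro x hx
          rw [degree_eq_of_isHomogeneous hp hx]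
          omega
        obtain ⟨q, hq⟩ := Ideal.mem_span_range_iff_exists_fun.mp (hk hpk)
        have hpq : p = ∑ i, homogeneousComponent (n - D) (q i) * F.poly i := by
          rw [← homogeneousComponent_eq_self hp]
          nth_rw 1 [← hq]
          rw [map_sum]
          exact Finset.sum_congr rfl fun i _ =>
            homogeneousComponent_mul_of_isHomogeneous (F.homogeneous i) (by omega)
        -- Replacing `F_i` by `x_i` in `p = ∑ q_i F_i` does not change the class and lowers the
        -- degree by `D - 1 ≥ 1`.
        have hlow := ih (n - D + 1) (by omega) (∑ i, homogeneousComponent (n - D) (q i) * X i)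
          (IsHomogeneous.sum _ _ _ fun i _ =>
            (homogeneousComponent_isHomogeneous _ _).mul (isHomogeneous_X K i))
        have hdiff : p - ∑ i, homogeneousComponent (n - D) (q i) * X i ∈ F.affIdeal := by
          rw [hpq, ← Finset.sum_sub_distrib]
          refine Ideal.sum_mem _ fun i _ => ?_
          rw [← mul_sub]
          exact Ideal.mul_mem_left _ _ (Ideal.subset_span ⟨i, rfl⟩)
        rw [← sub_add_cancel p (∑ i, homogeneousComponent (n - D) (q i) * X i)]
        exact Submodule.add_mem _ (Submodule.mem_sup_left hdiff) hlow
  rw [eq_top_iff]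
  intro p _
  rw [← sum_homogeneousComponent p]
  exact Submodule.sum_mem _ fun i _ => hhom i _ (homogeneousComponent_isHomogeneous i p)

theorem finite_zeroLocus_affIdeal [IsAlgClosed K] [Finite ι] (hD : 2 ≤ D) :
    (zeroLocus K F.affIdeal).Finite := by
  obtain ⟨k, hk⟩ := F.exists_affIdeal_sup_restrictTotalDegree hD
  have : Module.Finite K (MvPolynomial ι K ⧸ F.affIdeal) := by
    refine Module.Finite.of_surjective ((Ideal.Quotient.mkₐ K F.affIdeal).toLinearMap ∘ₗ
      (restrictTotalDegree ι K k).subtype) fun y => ?_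
    obtain ⟨p, rfl⟩ := Ideal.Quotient.mk_surjective y
    obtain ⟨a, ha, r, hr, rfl⟩ := Submodule.mem_sup.mp (hk ▸ Submodule.mem_top : p ∈ _)
    refine ⟨⟨r, hr⟩, ?_⟩
    have : Ideal.Quotient.mk F.affIdeal a = 0 := Ideal.Quotient.eq_zero_iff_mem.mpr ha
    simp [this]
  exact finite_zeroLocus_of_finite_quotient

/-- Otherwise all `F_i(u) = u_i F_b(u)` vanish, forcing `u = 0` against `u_b = 1`. -/
theorem eval_poly_ne_zero_of_mem_zeroLocus_fixedIdeal {b : ι} {u : ι → K}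
    (hu : u ∈ zeroLocus K (F.fixedIdeal b)) : eval u (F.poly b) ≠ 0 := by
  rw [mem_zeroLocus_fixedIdeal] at hu
  intro h
  have := F.no_common_zero u fun i => by rw [hu.1 i, h, mul_zero]
  simp [this] at hu

theorem smul_mem_zeroLocus_affIdeal {b : ι} {u : ι → K} (hD : 2 ≤ D)
    (hu : u ∈ zeroLocus K (F.fixedIdeal b)) {s : K} (hs : s ^ (D - 1) * eval u (F.poly b) = 1) :
    s • u ∈ zeroLocus K F.affIdeal := by
  rw [mem_zeroLocus_fixedIdeal] at hu
  rw [mem_zeroLocus_affIdeal]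
  intro i
  rw [eval_smul_of_isHomogeneous (F.homogeneous i), hu.1 i, Pi.smul_apply, smul_eq_mul]
  obtain ⟨D, rfl⟩ : ∃ E, D = E + 1 := ⟨D - 1, by omega⟩
  rw [Nat.add_sub_cancel] at hs
  linear_combination s * u i * hs

theorem exists_smul_mem_zeroLocus_affIdeal [IsAlgClosed K] {b : ι} {u : ι → K} (hD : 2 ≤ D)
    (hu : u ∈ zeroLocus K (F.fixedIdeal b)) :
    ∃ s : K, s ≠ 0 ∧ s • u ∈ zeroLocus K F.affIdeal := by
  have h0 := F.eval_poly_ne_zero_of_mem_zeroLocus_fixedIdeal hu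
  -- Since `F(s u) = s^D F_b(u) u`, the vector `s u` is fixed once `s^(D-1) = 1 / F_b(u)`.
  obtain ⟨s, hs⟩ := IsAlgClosed.exists_pow_nat_eq (eval u (F.poly b))⁻¹
    (show 0 < D - 1 by omega)
  have hs' : s ^ (D - 1) * eval u (F.poly b) = 1 := by rw [hs, inv_mul_cancel₀ h0]
  refine ⟨s, ?_, F.smul_mem_zeroLocus_affIdeal hD hu hs'⟩
  rintro rfl
  rw [zero_pow (by omega), zero_mul] at hs'
  exact zero_ne_one hs'

theorem finite_zeroLocus_fixedIdeal [IsAlgClosed K] [Finite ι] (hD : 2 ≤ D) (b : ι) :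
    (zeroLocus K (F.fixedIdeal b)).Finite := by
  refine ((F.finite_zeroLocus_affIdeal hD).image fun v => (v b)⁻¹ • v).subset fun u hu => ?_
  obtain ⟨s, hs, hsu⟩ := F.exists_smul_mem_zeroLocus_affIdeal hD hu
  refine ⟨_, hsu, ?_⟩
  rw [mem_zeroLocus_fixedIdeal] at hu
  simp [hu.2, hs]

theorem rep_chart_ne_zero (P : ℙ K (ι → K)) : P.rep (chart P) ≠ 0 :=
  Classical.choose_spec (Function.ne_iff.mp P.rep_nonzero)

theorem coords_chart (P : ℙ K (ι → K)) : coords P (chart P) = 1 :=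
  div_self (rep_chart_ne_zero P)

theorem coords_ne_zero (P : ℙ K (ι → K)) : coords P ≠ 0 := fun h => by
  have := coords_chart P
  rw [h] at this
  exact zero_ne_one this

theorem rep_eq_smul_coords (P : ℙ K (ι → K)) : P.rep = P.rep (chart P) • coords P := by
  ext i
  rw [Pi.smul_apply, smul_eq_mul, coords, mul_div_cancel₀ _ (rep_chart_ne_zero P)]

theorem mk_eq_iff_exists_smul_coords {v : ι → K} (hv : v ≠ 0) (P : ℙ K (ι → K)) :
    Projectivization.mk K v hv = P ↔ ∃ s : K, s ≠ 0 ∧ v = s • coords P := by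
  rw [← P.mk_rep, Projectivization.mk_eq_mk_iff', P.mk_rep]
  constructor
  · rintro ⟨a, rfl⟩
    refine ⟨a * P.rep (chart P), ?_, by rw [mul_smul, ← rep_eq_smul_coords]⟩
    refine mul_ne_zero ?_ (rep_chart_ne_zero P)
    rintro rfl
    exact hv (zero_smul _ _)
  · rintro ⟨s, hs, rfl⟩
    refine ⟨s * (P.rep (chart P))⁻¹, ?_⟩
    nth_rw 2 [rep_eq_smul_coords P]
    rw [smul_smul, mul_assoc, inv_mul_cancel₀ (rep_chart_ne_zero P), mul_one]

theorem mem_fixedPoints_iff {P : ℙ K (ι → K)} :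
    P ∈ Function.fixedPoints F.map ↔ coords P ∈ zeroLocus K (F.fixedIdeal (chart P)) := by
  rw [Function.mem_fixedPoints, Function.IsFixedPt, map, mk_eq_iff_exists_smul_coords,
    mem_zeroLocus_fixedIdeal, rep_eq_smul_coords P]
  have h0 : P.rep (chart P) ^ D ≠ 0 := pow_ne_zero _ (rep_chart_ne_zero P)
  simp only [eval_smul_of_isHomogeneous (F.homogeneous _), funext_iff, Pi.smul_apply, smul_eq_mul,
    coords_chart, and_true]
  constructor
  · rintro ⟨s, hs, h⟩ i
    have hb := h (chart P)
    rw [coords_chart, mul_one] at hb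
    refine mul_left_cancel₀ h0 ?_
    rw [h i, ← hb]
    ring
  · intro h
    refine ⟨P.rep (chart P) ^ D * eval (coords P) (F.poly (chart P)), mul_ne_zero h0 ?_, fun i => ?_⟩
    · exact F.eval_poly_ne_zero_of_mem_zeroLocus_fixedIdeal
        (mem_zeroLocus_fixedIdeal.mpr ⟨h, coords_chart P⟩)
    · rw [h i]
      ring

/-- Converse of the scaling condition, read off from the coordinate `chart P`, where `coords P` is
1. -/
theorem pow_mul_eval_coords {P : ℙ K (ι → K)} (hD : 2 ≤ D) {s : K} (hs : s ≠ 0)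
    (h : s • coords P ∈ zeroLocus K F.affIdeal) :
    s ^ (D - 1) * eval (coords P) (F.poly (chart P)) = 1 := by
  rw [mem_zeroLocus_affIdeal] at h
  have := h (chart P)
  rw [eval_smul_of_isHomogeneous (F.homogeneous _), Pi.smul_apply, coords_chart, smul_eq_mul] at this
  refine mul_left_cancel₀ hs ?_
  rw [← mul_assoc, ← pow_succ', show D - 1 + 1 = D by omega, this]

theorem mk_mem_fixedPoints {v : ι → K} (hv : v ≠ 0) (h : v ∈ zeroLocus K F.affIdeal) :
    Projectivization.mk K v hv ∈ Function.fixedPoints F.map := by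
  obtain ⟨s, hs, hsv⟩ := (mk_eq_iff_exists_smul_coords hv _).mp rfl
  generalize Projectivization.mk K v hv = P at hsv
  subst hsv
  rw [mem_fixedPoints_iff, mem_zeroLocus_fixedIdeal]
  refine ⟨fun i => ?_, coords_chart P⟩
  rw [mem_zeroLocus_affIdeal] at h
  have hi := h i
  have hb := h (chart P)
  rw [eval_smul_of_isHomogeneous (F.homogeneous _), Pi.smul_apply, smul_eq_mul] at hi hb
  rw [coords_chart] at hb
  refine mul_left_cancel₀ (pow_ne_zero D hs) ?_
  linear_combination hi - coords P i * hb

theorem finite_fixedPoints [IsAlgClosed K] [Finite ι] (hD : 2 ≤ D) :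
    (Function.fixedPoints F.map).Finite := by
  have : Finite {v // v ∈ zeroLocus K F.affIdeal ∧ v ≠ 0} :=
    Set.Finite.subset (F.finite_zeroLocus_affIdeal hD) fun v hv => hv.1
  refine (Set.finite_range fun v : {v // v ∈ zeroLocus K F.affIdeal ∧ v ≠ 0} =>
    Projectivization.mk K v.1 v.2.2).subset fun P hP => ?_
  obtain ⟨s, hs, h⟩ := F.exists_smul_mem_zeroLocus_affIdeal hD ((F.mem_fixedPoints_iff).mp hP)
  exact ⟨⟨s • coords P, h, smul_ne_zero hs (coords_ne_zero P)⟩,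
    (mk_eq_iff_exists_smul_coords _ P).mpr ⟨s, hs, rfl⟩⟩

end ProjEndo

/-! ### Multiplicities of the fixed vectors over one fixed point. -/

theorem mem_zeroLocus_sup_span_one_sub_iff {I : Ideal (MvPolynomial ι K)} {e : MvPolynomial ι K}
    {T : Set (ι → K)} (hev : ∀ v ∈ zeroLocus K I, (v ∈ T → eval v e = 1) ∧ (v ∉ T → eval v e = 0))
    {v : ι → K} : v ∈ zeroLocus K (I ⊔ Ideal.span {1 - e}) ↔ v ∈ zeroLocus K I ∧ v ∈ T := by
  rw [zeroLocus_sup_eq, Set.mem_inter_iff, mem_zeroLocus_span_iff_eval]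
  refine and_congr_right fun hv => ?_
  by_cases hT : v ∈ T
  · simp [hT, (hev v hv).1 hT]
  · simp [hT, (hev v hv).2 hT]

open scoped Classical in
/-- The multiplicities of the points of a union of components sum up to its degree. -/
theorem finrank_quotient_sup_span_one_sub [IsAlgClosed K] [Finite ι]
    {I : Ideal (MvPolynomial ι K)} (h : (zeroLocus K I).Finite) {e : MvPolynomial ι K}
    (he : e * (1 - e) ∈ I) {T : Set (ι → K)}
    (hev : ∀ v ∈ zeroLocus K I, (v ∈ T → eval v e = 1) ∧ (v ∉ T → eval v e = 0)) :
    Module.finrank K (MvPolynomial ι K ⧸ (I ⊔ Ideal.span {1 - e})) =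
      ∑ v ∈ h.toFinset with v ∈ T, localMult I v := by
  have h' : (zeroLocus K (I ⊔ Ideal.span {1 - e})).Finite :=
    h.subset (zeroLocus_anti_mono le_sup_left)
  rw [finrank_quotient_eq_sum_localMult h']
  refine Finset.sum_congr ?_ fun v hv => ?_
  · ext v
    simp only [Set.Finite.mem_toFinset, Finset.mem_filter, mem_zeroLocus_sup_span_one_sub_iff hev]
  · rw [Finset.mem_filter, Set.Finite.mem_toFinset] at hv
    exact localMult_sup_span_one_sub he (by rw [(hev v hv.1).1 hv.2]; exact one_ne_zero)

theorem mem_zeroLocus_of_algHom {A : Type*} [CommRing A] [Algebra K A]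
    {I : Ideal (MvPolynomial ι K)} (x : ι → A) (hx : ∀ p ∈ I, aeval x p = 0) (ψ : A →ₐ[K] K) :
    (fun i => ψ (x i)) ∈ zeroLocus K I := fun p hp => by
  rw [show aeval (fun i => ψ (x i)) p = ψ (aeval x p) from (comp_aeval_apply x ψ p).symm, hx p hp,
    map_zero]

/-- An idempotent modulo `I` that takes the value `1` at all points of `A` becomes `1` in `A`. -/
theorem aeval_one_sub_eq_zero [IsAlgClosed K] {A : Type*} [CommRing A] [Algebra K A]
    [Module.Finite K A] {I : Ideal (MvPolynomial ι K)} {e : MvPolynomial ι K}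
    (he : e * (1 - e) ∈ I) (x : ι → A) (hx : ∀ p ∈ I, aeval x p = 0)
    (h : ∀ ψ : A →ₐ[K] K, eval (fun i => ψ (x i)) e = 1) : aeval x (1 - e) = 0 := by
  have hidem := hx _ he
  rw [map_mul] at hidem
  have hunit : IsUnit (aeval x e) := isUnit_of_forall_algHom_ne_zero (K := K) fun ψ => by
    rw [show ψ (aeval x e) = aeval (fun i => ψ (x i)) e from comp_aeval_apply x ψ e, aeval_eq_eval, h]
    exact one_ne_zero
  exact hunit.mul_right_eq_zero.mp hidem

namespace ProjEndo

variable {D : ℕ} (F : ProjEndo K ι D)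

theorem aeval_eq_zero_of_mem_affIdeal {A : Type*} [CommRing A] [Algebra K A] {x : ι → A}
    (hx : ∀ i, aeval x (F.poly i) = x i) {p : MvPolynomial ι K} (hp : p ∈ F.affIdeal) :
    aeval x p = 0 := by
  have hle : F.affIdeal ≤ RingHom.ker (aeval (R := K) x) := by
    rw [affIdeal, Ideal.span_le]
    rintro _ ⟨i, rfl⟩
    simp [RingHom.mem_ker, hx]
  exact hle hp

theorem aeval_eq_zero_of_mem_fixedIdeal {A : Type*} [CommRing A] [Algebra K A] {x : ι → A} {b : ι}
    (hx : ∀ i, aeval x (F.poly i) = x i * aeval x (F.poly b)) (hb : x b = 1)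
    {p : MvPolynomial ι K} (hp : p ∈ F.fixedIdeal b) :
    aeval x p = 0 := by
  have hle : F.fixedIdeal b ≤ RingHom.ker (aeval (R := K) x) := by
    rw [fixedIdeal, sup_le_iff, Ideal.span_le, Ideal.span_le]
    constructor
    · rintro _ ⟨i, rfl⟩
      simp [RingHom.mem_ker, hx i]
    · rintro _ rfl
      simp [RingHom.mem_ker, hb]
  exact hle hp

/-- If `A` is generated by a fixed point `x` with `x_b = 1`, and `B` by a fixed point `y` of the
affine cone with `y_b` invertible, and if the two correspond to each other under scaling, then `B`
is the extension of `A` by a `(D - 1)`-st root of `1 / F_b(x)`. -/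
theorem finrank_eq_mul_of_scaling (hD : 2 ≤ D) {b : ι} {J L : Ideal (MvPolynomial ι K)}
    (hJ : F.fixedIdeal b ≤ J) (hL : F.affIdeal ≤ L) [Nontrivial (MvPolynomial ι K ⧸ J)]
    {c : MvPolynomial ι K ⧸ J} (hc : c * Ideal.Quotient.mk J (F.poly b) = 1)
    {r : MvPolynomial ι K ⧸ L} (hr : r * Ideal.Quotient.mk L (X b) = 1)
    (hJL : ∀ p ∈ J, aeval (fun i => r * Ideal.Quotient.mk L (X i)) p = 0)
    (hLJ : ∀ p ∈ L, aeval (fun i => AdjoinRoot.root (Polynomial.X ^ (D - 1) - Polynomial.C c) *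
      AdjoinRoot.of (Polynomial.X ^ (D - 1) - Polynomial.C c) (Ideal.Quotient.mk J (X i))) p = 0) :
    Module.finrank K (MvPolynomial ι K ⧸ L) = (D - 1) * Module.finrank K (MvPolynomial ι K ⧸ J) := by
  set g : Polynomial (MvPolynomial ι K ⧸ J) := Polynomial.X ^ (D - 1) - Polynomial.C c with hg
  have hmonic : g.Monic := Polynomial.monic_X_pow_sub_C c (by omega)
  let pb := AdjoinRoot.powerBasis' hmonic
  have : Module.Free (MvPolynomial ι K ⧸ J) (AdjoinRoot g) := Module.Free.of_basis pb.basis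
  -- The rank only needs `g` to be monic, so separability plays no role.
  have hdim : Module.finrank (MvPolynomial ι K ⧸ J) (AdjoinRoot g) = D - 1 := by
    rw [pb.finrank, AdjoinRoot.powerBasis'_dim, hg, Polynomial.natDegree_X_pow_sub_C]
  -- The two directions of scaling: `φ` sends `y` to `root * x`, and `θ` sends `x` to `y / y_b`,
  -- with `r = 1 / y_b`.
  let φ : (MvPolynomial ι K ⧸ L) →ₐ[K] AdjoinRoot g := Ideal.Quotient.liftₐ L (aeval _) hLJ
  let θ : (MvPolynomial ι K ⧸ J) →ₐ[K] (MvPolynomial ι K ⧸ L) :=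
    Ideal.Quotient.liftₐ J (aeval _) hJL
  have hφ (i : ι) : φ (Ideal.Quotient.mk L (X i)) =
      AdjoinRoot.root g * AdjoinRoot.of g (Ideal.Quotient.mk J (X i)) := aeval_X _ i
  have hθ (i : ι) : θ (Ideal.Quotient.mk J (X i)) = r * Ideal.Quotient.mk L (X i) := aeval_X _ i
  have hxb : Ideal.Quotient.mk J (X b) = 1 := by
    rw [← map_one (Ideal.Quotient.mk J), Ideal.Quotient.mk_eq_mk_iff_sub_mem]
    exact hJ (Ideal.mem_sup_right (Ideal.subset_span rfl))
  have hyb : Ideal.Quotient.mk L (F.poly b) = Ideal.Quotient.mk L (X b) := by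
    rw [Ideal.Quotient.mk_eq_mk_iff_sub_mem]
    exact hL (Ideal.subset_span ⟨b, rfl⟩)
  have hθF : θ (Ideal.Quotient.mk J (F.poly b)) = r ^ D * Ideal.Quotient.mk L (X b) := by
    rw [← hyb]
    refine (aeval_mul_of_isHomogeneous (F.homogeneous b) r _).trans ?_
    congr 1
    exact (DFunLike.congr_fun (aeval_unique (Ideal.Quotient.mkₐ K L)) (F.poly b)).symm
  -- Both `y_b^(D-1)` and `θ c` are inverse to `r^D y_b`, the image of `F_b(x)`; hence `θ` extends
  -- to the adjoined root by `root ↦ y_b`.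
  have hroot : Polynomial.eval₂ (θ : (MvPolynomial ι K ⧸ J) →+* _)
      (Ideal.Quotient.mk L (X b)) g = 0 := by
    rw [hg, Polynomial.eval₂_sub, Polynomial.eval₂_X_pow, Polynomial.eval₂_C, sub_eq_zero]
    have h1 : θ c * (r ^ D * Ideal.Quotient.mk L (X b)) = 1 := by
      rw [← hθF, ← map_mul, hc, map_one]
    have h2 : Ideal.Quotient.mk L (X b) ^ (D - 1) * (r ^ D * Ideal.Quotient.mk L (X b)) = 1 := by
      rw [mul_comm (r ^ D), ← mul_assoc, ← pow_succ, show D - 1 + 1 = D by omega, ← mul_pow,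
        mul_comm, hr, one_pow]
    exact (left_inv_eq_right_inv h2 ((mul_comm _ _).trans h1))
  let Θ : AdjoinRoot g →ₐ[K] (MvPolynomial ι K ⧸ L) := AdjoinRoot.liftAlgHom g θ _ hroot
  have hΘroot : Θ (AdjoinRoot.root g) = Ideal.Quotient.mk L (X b) := AdjoinRoot.lift_root hroot
  have hΘof (x : MvPolynomial ι K ⧸ J) : Θ (AdjoinRoot.of g x) = θ x := AdjoinRoot.lift_of hroot
  have hφb : φ (Ideal.Quotient.mk L (X b)) = AdjoinRoot.root g := by
    rw [hφ, hxb, map_one, mul_one]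
  have hφr : φ r * AdjoinRoot.root g = 1 := by rw [← hφb, ← map_mul, hr, map_one]
  have hleft : Function.LeftInverse Θ φ := by
    have : Θ.comp φ = AlgHom.id K _ := by
      refine Ideal.Quotient.algHom_ext _ (MvPolynomial.algHom_ext fun i => ?_)
      change Θ (φ (Ideal.Quotient.mk L (X i))) = Ideal.Quotient.mk L (X i)
      rw [hφ, map_mul, hΘroot, hΘof, hθ, ← mul_assoc, mul_comm _ r, hr, one_mul]
    exact DFunLike.congr_fun this
  have hright : Function.RightInverse Θ φ := by
    have hof (x : MvPolynomial ι K ⧸ J) : φ (θ x) = AdjoinRoot.of g x := by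
      have : φ.comp θ = (IsScalarTower.toAlgHom K _ (AdjoinRoot g)) := by
        refine Ideal.Quotient.algHom_ext _ (MvPolynomial.algHom_ext fun i => ?_)
        change φ (θ (Ideal.Quotient.mk J (X i))) = AdjoinRoot.of g (Ideal.Quotient.mk J (X i))
        rw [hθ, map_mul, hφ, ← mul_assoc, hφr, one_mul]
      exact DFunLike.congr_fun this x
    intro z
    induction z using AdjoinRoot.induction_on with
    | ih q =>
      induction q using Polynomial.induction_on' with
      | add p q hp hq => rw [map_add, map_add, map_add, hp, hq]
      | monomial n a =>
        rw [← Polynomial.C_mul_X_pow_eq_monomial, map_mul, map_pow, AdjoinRoot.mk_C,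
          AdjoinRoot.mk_X, map_mul, map_mul, map_pow, map_pow, hΘof, hof, hΘroot, hφb]
  rw [(LinearEquiv.ofBijective φ.toLinearMap ⟨hleft.injective, hright.surjective⟩).finrank_eq,
    ← Module.finrank_mul_finrank K (MvPolynomial ι K ⧸ J) (AdjoinRoot g), hdim, mul_comm]

open scoped Classical in
/-- The multiplicities of the fixed vectors over a fixed point `P` sum up to `D - 1` times the
multiplicity of `P`. -/
theorem sum_localMult_affIdeal [IsAlgClosed K] [Finite ι] (hD : 2 ≤ D) {P : ℙ K (ι → K)}
    (hP : P ∈ Function.fixedPoints F.map) :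
    ∑ v ∈ (F.finite_zeroLocus_affIdeal hD).toFinset with ∃ s : K, s ≠ 0 ∧ v = s • coords P,
      localMult F.affIdeal v = (D - 1) * F.fixedMult P := by
  set b := chart P
  set u := coords P
  have hu : u ∈ zeroLocus K (F.fixedIdeal b) := F.mem_fixedPoints_iff.mp hP
  have hub : u b = 1 := coords_chart P
  have hfinJ := F.finite_zeroLocus_fixedIdeal hD b
  have hfinL := F.finite_zeroLocus_affIdeal hD
  -- The idempotents cut out the component at `u` and the union of the components on the punctured
  -- line through `u`. The total multiplicities then become dimensions of the quotients by `J` and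
  -- `L`.
  obtain ⟨e, he, hev⟩ := exists_idempotent hfinJ {u}
  obtain ⟨e', he', hev'⟩ := exists_idempotent hfinL {v | ∃ s : K, s ≠ 0 ∧ v = s • u}
  have hmult := finrank_quotient_sup_span_one_sub hfinJ he hev
  rw [Finset.sum_eq_single u (by simp +contextual) (by simp_all)] at hmult
  rw [fixedMult_eq_localMult, ← hmult]
  refine (finrank_quotient_sup_span_one_sub hfinL he' hev').symm.trans ?_
  set J := F.fixedIdeal b ⊔ Ideal.span {1 - e} with hJ
  set L := F.affIdeal ⊔ Ideal.span {1 - e'} with hL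
  have hVJ {v : ι → K} (hv : v ∈ zeroLocus K J) : v = u :=
    ((mem_zeroLocus_sup_span_one_sub_iff hev).mp hv).2
  have huJ : u ∈ zeroLocus K J := (mem_zeroLocus_sup_span_one_sub_iff hev).mpr ⟨hu, rfl⟩
  have hVL {v : ι → K} (hv : v ∈ zeroLocus K L) : ∃ s : K, s ≠ 0 ∧ v = s • u :=
    ((mem_zeroLocus_sup_span_one_sub_iff hev').mp hv).2
  have hFu := F.eval_poly_ne_zero_of_mem_zeroLocus_fixedIdeal hu
  have : Nontrivial (MvPolynomial ι K ⧸ J) := by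
    refine Ideal.Quotient.nontrivial_iff.mpr fun htop => ?_
    have := huJ 1 (htop ▸ Submodule.mem_top)
    simp at this
  have : Module.Finite K (MvPolynomial ι K ⧸ J) :=
    finite_quotient_of_finite_zeroLocus (hfinJ.subset (zeroLocus_anti_mono le_sup_left))
  have : Module.Finite K (MvPolynomial ι K ⧸ L) :=
    finite_quotient_of_finite_zeroLocus (hfinL.subset (zeroLocus_anti_mono le_sup_left))
  obtain ⟨c, hc⟩ := (isUnit_mk_of_forall_eval_ne_zero (I := J) (p := F.poly b) fun v hv => by
    rwa [hVJ hv]).exists_left_inv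
  obtain ⟨r, hr⟩ := (isUnit_mk_of_forall_eval_ne_zero (I := L) (p := X b) fun v hv => by
    obtain ⟨s, hs, rfl⟩ := hVL hv
    simpa [hub] using hs).exists_left_inv
  have hJx (p : MvPolynomial ι K) :
      aeval (fun i => Ideal.Quotient.mk J (X i)) p = Ideal.Quotient.mk J p :=
    (DFunLike.congr_fun (aeval_unique (Ideal.Quotient.mkₐ K J)) p).symm
  have hLx (p : MvPolynomial ι K) :
      aeval (fun i => Ideal.Quotient.mk L (X i)) p = Ideal.Quotient.mk L p :=
    (DFunLike.congr_fun (aeval_unique (Ideal.Quotient.mkₐ K L)) p).symm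
  have hLF (i : ι) : Ideal.Quotient.mk L (F.poly i) = Ideal.Quotient.mk L (X i) := by
    rw [Ideal.Quotient.mk_eq_mk_iff_sub_mem]
    exact Ideal.mem_sup_left (Ideal.subset_span ⟨i, rfl⟩)
  have hJF (i : ι) : Ideal.Quotient.mk J (F.poly i) =
      Ideal.Quotient.mk J (X i) * Ideal.Quotient.mk J (F.poly b) := by
    rw [← map_mul, Ideal.Quotient.mk_eq_mk_iff_sub_mem]
    exact Ideal.mem_sup_left (Ideal.mem_sup_left (Ideal.subset_span ⟨i, rfl⟩))
  refine F.finrank_eq_mul_of_scaling hD le_sup_left le_sup_left hc hr ?_ ?_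
  · have hfix : ∀ p ∈ F.fixedIdeal b, aeval (fun i => r * Ideal.Quotient.mk L (X i)) p = 0 := by
      intro p hp
      refine F.aeval_eq_zero_of_mem_fixedIdeal (fun i => ?_) hr hp
      rw [aeval_mul_of_isHomogeneous (F.homogeneous i), aeval_mul_of_isHomogeneous (F.homogeneous b),
        hLx, hLx, hLF, hLF]
      linear_combination -(r ^ D * Ideal.Quotient.mk L (X i)) * hr
    intro p hp
    obtain ⟨p₁, hp₁, p₂, hp₂, rfl⟩ := Submodule.mem_sup.mp hp
    obtain ⟨q, rfl⟩ := Ideal.mem_span_singleton.mp hp₂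
    -- The equation `e = 1` is checked on `K`-points only: each point of `L` is some `s • u`, and
    -- dividing by its coordinate `b` gives `u`.
    rw [map_add, hfix p₁ hp₁, zero_add, map_mul, aeval_one_sub_eq_zero he _ hfix fun ψ => ?_,
      zero_mul]
    exact (hev _ (mem_zeroLocus_of_algHom _ hfix ψ)).1 (by
      obtain ⟨s, hs, hv⟩ := hVL (mem_zeroLocus_of_algHom (I := L)
        (fun i => Ideal.Quotient.mk L (X i))
        (fun p hp => by rw [hLx, Ideal.Quotient.eq_zero_iff_mem.mpr hp]) ψ)
      have hψr : ψ r * s = 1 := by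
        have := congrFun hv b
        rw [Pi.smul_apply, hub, smul_eq_mul, mul_one] at this
        rw [← this, ← map_mul, hr, map_one]
      refine funext fun i => ?_
      have := congrFun hv i
      rw [Pi.smul_apply, smul_eq_mul] at this
      rw [map_mul, this, ← mul_assoc, hψr, one_mul])
  · set g : Polynomial (MvPolynomial ι K ⧸ J) := Polynomial.X ^ (D - 1) - Polynomial.C c with hg
    have hmonic : g.Monic := Polynomial.monic_X_pow_sub_C c (by omega)
    have : Module.Finite (MvPolynomial ι K ⧸ J) (AdjoinRoot g) := hmonic.finite_adjoinRoot
    have : Module.Finite K (AdjoinRoot g) := Module.Finite.trans (MvPolynomial ι K ⧸ J) _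
    have hroot : AdjoinRoot.root g ^ (D - 1) = AdjoinRoot.of g c := by
      have := AdjoinRoot.eval₂_root g
      rwa [hg, Polynomial.eval₂_sub, Polynomial.eval₂_X_pow, Polynomial.eval₂_C, sub_eq_zero] at this
    have hof (p : MvPolynomial ι K) :
        aeval (fun i => AdjoinRoot.of g (Ideal.Quotient.mk J (X i))) p =
          AdjoinRoot.of g (Ideal.Quotient.mk J p) :=
      (DFunLike.congr_fun (aeval_unique ((IsScalarTower.toAlgHom K (MvPolynomial ι K ⧸ J)
        (AdjoinRoot g)).comp (Ideal.Quotient.mkₐ K J))) p).symm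
    have hsF : AdjoinRoot.root g ^ (D - 1) * AdjoinRoot.of g (Ideal.Quotient.mk J (F.poly b)) = 1 := by
      rw [hroot, ← map_mul, hc, map_one]
    have haff : ∀ p ∈ F.affIdeal, aeval (fun i => AdjoinRoot.root g *
        AdjoinRoot.of g (Ideal.Quotient.mk J (X i))) p = 0 := by
      intro p hp
      refine F.aeval_eq_zero_of_mem_affIdeal (fun i => ?_) hp
      rw [aeval_mul_of_isHomogeneous (F.homogeneous i), hof, hJF, map_mul]
      nth_rw 1 [show D = D - 1 + 1 by omega]
      linear_combination AdjoinRoot.root g * AdjoinRoot.of g (Ideal.Quotient.mk J (X i)) * hsF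
    intro p hp
    obtain ⟨p₁, hp₁, p₂, hp₂, rfl⟩ := Submodule.mem_sup.mp hp
    obtain ⟨q, rfl⟩ := Ideal.mem_span_singleton.mp hp₂
    -- Again it suffices to look at `K`-points, which are `ψ(root) • u`; `ψ(root)` is nonzero since
    -- `root^(D-1)` is a unit.
    rw [map_add, haff p₁ hp₁, zero_add, map_mul, aeval_one_sub_eq_zero he' _ haff fun ψ => ?_,
      zero_mul]
    refine (hev' _ (mem_zeroLocus_of_algHom _ haff ψ)).1 ⟨ψ (AdjoinRoot.root g), fun h0 => ?_, ?_⟩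
    · have := congrArg ψ hsF
      rw [map_mul, map_pow, h0, zero_pow (by omega), zero_mul, map_one] at this
      exact zero_ne_one this
    · have hw := hVJ (mem_zeroLocus_of_algHom (I := J)
        (fun i => AdjoinRoot.of g (Ideal.Quotient.mk J (X i)))
        (fun p hp => by rw [hof, Ideal.Quotient.eq_zero_iff_mem.mpr hp, map_zero]) ψ)
      refine funext fun i => ?_
      rw [← hw, map_mul, Pi.smul_apply, smul_eq_mul]

end ProjEndo

/-! ### Jacobians of the cone map, multipliers, and the multiplicity of the origin. -/

/-- Splitting off an eigenvector `u` with `u b = 1` from the characteristic polynomial. -/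
theorem Matrix.charpoly_eq_X_sub_C_mul_of_mulVec_eq_smul {R : Type*} [CommRing R] [Fintype ι]
    [DecidableEq ι] (A : Matrix ι ι R) {u : ι → R} {b : ι} (hb : u b = 1) {c : R}
    (hA : A.mulVec u = c • u) :
    A.charpoly = (Polynomial.X - Polynomial.C c) *
      (Matrix.of fun i j : {i // i ≠ b} => A i j - u i * A b j).charpoly := by
  -- The matrix `1 + N` sends the basis vector `e_b` to `u` and fixes the others, and `N * N = 0`
  -- because `u b = 1`. Conjugation by it makes column `b` equal to `c e_b`, so the matrix becomes
  -- block triangular.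
  set N : Matrix ι ι R := Matrix.vecMulVec (u - Pi.single b 1) (Pi.single b 1) with hN
  have hNN : N * N = 0 := by
    rw [hN, Matrix.vecMulVec_mul_vecMulVec]
    simp [hb]
  have hinv : (1 - N) * (1 + N) = 1 := by noncomm_ring [hNN]
  have hinv' : (1 + N) * (1 - N) = 1 := by noncomm_ring [hNN]
  set M : Matrix ι ι R := (1 - N) * (A * (1 + N)) with hM
  have hconj : M.charpoly = A.charpoly := by
    rw [hM, Matrix.charpoly_mul_comm, mul_assoc, hinv', mul_one]
  have hMij (i j : ι) (hj : j ≠ b) : M i j = A i j - (u i - (Pi.single b 1 : ι → R) i) * A b j := by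
    have hAN : (A * N) b j = 0 ∧ (A * N) i j = 0 := by
      simp [hN, Matrix.mul_vecMulVec, Matrix.vecMulVec_apply, hj]
    have hNX (X : Matrix ι ι R) :
        (N * X) i j = (u i - (Pi.single b 1 : ι → R) i) * X b j := by
      simp [hN, Matrix.vecMulVec_mul, Matrix.vecMulVec_apply]
    rw [hM, Matrix.sub_mul, Matrix.sub_apply, Matrix.one_mul, hNX, Matrix.mul_add, Matrix.mul_one,
      Matrix.add_apply, Matrix.add_apply, hAN.1, hAN.2, add_zero, add_zero]
  have hMb (i : ι) : M i b = c * (Pi.single b 1 : ι → R) i := by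
    have hU : (1 + N).mulVec (Pi.single b 1) = u := by
      rw [Matrix.add_mulVec, Matrix.one_mulVec, hN, Matrix.vecMulVec_mulVec]
      simp
    have hU' : (1 - N).mulVec u = Pi.single b 1 := by
      rw [← hU, Matrix.mulVec_mulVec, hinv, Matrix.one_mulVec]
    have : M.mulVec (Pi.single b 1) = c • (Pi.single b 1 : ι → R) := by
      rw [hM, ← Matrix.mulVec_mulVec, ← Matrix.mulVec_mulVec, hU, hA, Matrix.mulVec_smul, hU']
    have := congrFun this i
    rwa [Matrix.mulVec_single_one] at this
  rw [← hconj, Matrix.charpoly, Matrix.twoBlockTriangular_det' _ (· ≠ b), mul_comm]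
  · congr 1
    · have huniq (i : {i // ¬ i ≠ b}) : i = ⟨b, fun h => h rfl⟩ :=
        Subtype.ext (not_not.mp i.2)
      let : Unique {i // ¬ i ≠ b} := ⟨⟨⟨b, fun h => h rfl⟩⟩, huniq⟩
      rw [Matrix.det_unique]
      change M.charmatrix b b = _
      rw [Matrix.charmatrix_apply_eq, hMb]
      simp
    · rw [Matrix.charpoly]
      congr 1
      ext1 i j
      rw [Matrix.toSquareBlockProp_def, Matrix.of_apply, Matrix.charmatrix_apply,
        Matrix.charmatrix_apply, hMij i j j.2, Matrix.of_apply, Pi.single_eq_of_ne i.2, sub_zero]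
      simp [Matrix.diagonal_apply, Subtype.ext_iff]
  · intro i hi j hj
    obtain rfl := not_not.mp hj
    rw [Matrix.charmatrix_apply_ne _ _ _ hi, hMb, Pi.single_eq_of_ne hi]
    simp

theorem pointIdeal_zero : ProjEndo.pointIdeal (0 : ι → K) = idealOfVars ι K := by
  ext p
  rw [mem_pointIdeal, ← pow_one (idealOfVars ι K), mem_pow_idealOfVars_iff', eval_zero,
    constantCoeff_eq]
  simp [Finsupp.degree_eq_zero_iff]

theorem zeroLocus_pointIdeal (v : ι → K) : zeroLocus K (ProjEndo.pointIdeal v) = {v} := by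
  refine Set.Subset.antisymm (fun w hw => funext fun i => ?_) ?_
  · have := mem_zeroLocus_iff_eval.mp hw (X i - C (v i)) (by simp [mem_pointIdeal])
    simpa [sub_eq_zero] using this
  · rintro _ rfl
    exact mem_zeroLocus_iff_eval.mpr fun p hp => hp

theorem localMult_pointIdeal [IsAlgClosed K] [Finite ι] (v : ι → K) :
    localMult (ProjEndo.pointIdeal v) v = 1 := by
  have hfin : (zeroLocus K (ProjEndo.pointIdeal v)).Finite := by
    rw [zeroLocus_pointIdeal]
    exact Set.finite_singleton v
  have h := finrank_quotient_eq_sum_localMult hfin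
  rw [show hfin.toFinset = {v} by ext; simp [zeroLocus_pointIdeal, -mem_zeroLocus_iff],
    Finset.sum_singleton] at h
  rw [← h]
  have hker : ProjEndo.pointIdeal v = RingHom.ker (aeval v : MvPolynomial ι K →ₐ[K] K) := by
    ext p
    rw [mem_pointIdeal, RingHom.mem_ker, aeval_eq_eval]
  have hsurj : Function.Surjective (aeval v : MvPolynomial ι K →ₐ[K] K) := fun a =>
    ⟨C a, by simp⟩
  rw [((Ideal.quotientEquivAlgOfEq K hker).trans
    (Ideal.quotientKerAlgEquivOfSurjective hsurj)).toLinearEquiv.finrank_eq, Module.finrank_self]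

namespace ProjEndo

variable {D : ℕ} (F : ProjEndo K ι D)

/-- The Jacobian matrix at `v` of the self-map of the affine cone given by `F`. -/
def coneJacobian (v : ι → K) : Matrix ι ι K :=
  Matrix.of fun i j => eval v (pderiv j (F.poly i))

theorem coneJacobian_smul_apply (s : K) (v : ι → K) (i j : ι) :
    F.coneJacobian (s • v) i j = s ^ (D - 1) * eval v (pderiv j (F.poly i)) :=
  eval_smul_of_isHomogeneous (F.homogeneous i).pderiv s v

theorem coneJacobian_zero (hD : 2 ≤ D) : F.coneJacobian 0 = 0 := by
  ext i j
  rw [← zero_smul K (0 : ι → K), coneJacobian_smul_apply, zero_pow (by omega), zero_mul]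
  rfl

/-- Euler's identity `∑ x_j ∂_j F_i = D F_i`, evaluated where `F(v) = v`. -/
theorem coneJacobian_mulVec [Fintype ι] {v : ι → K} (hv : v ∈ zeroLocus K F.affIdeal) :
    (F.coneJacobian v).mulVec v = (D : K) • v := by
  ext i
  have := congrArg (eval v) (F.homogeneous i).sum_X_mul_pderiv
  rw [map_sum, map_nsmul, mem_zeroLocus_affIdeal.mp hv i] at this
  rw [Pi.smul_apply, smul_eq_mul, ← nsmul_eq_mul, ← this, Matrix.mulVec, dotProduct]
  refine Finset.sum_congr rfl fun j _ => ?_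
  rw [map_mul, eval_X, mul_comm]
  rfl

/-- At a fixed vector over the fixed point `P`, the characteristic polynomial of the Jacobian matrix
of the cone map is the multiplier polynomial of `P` times the factor `t - D` of the radial
direction. -/
theorem charpoly_coneJacobian [Fintype ι] [DecidableEq ι] (hD : 2 ≤ D) {P : ℙ K (ι → K)} {s : K}
    (hs : s ≠ 0) (hv : s • coords P ∈ zeroLocus K F.affIdeal) :
    (F.coneJacobian (s • coords P)).charpoly =
      (Polynomial.X - Polynomial.C (D : K)) * F.multiplierPoly P := by
  have hpow := F.pow_mul_eval_coords hD hs hv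
  have hP := F.mk_mem_fixedPoints (smul_ne_zero hs (coords_ne_zero P)) hv
  rw [(mk_eq_iff_exists_smul_coords _ P).mpr ⟨s, hs, rfl⟩, mem_fixedPoints_iff] at hP
  have hF0 := F.eval_poly_ne_zero_of_mem_zeroLocus_fixedIdeal hP
  have hFi := (mem_zeroLocus_fixedIdeal.mp hP).1
  have heig : (F.coneJacobian (s • coords P)).mulVec (coords P) = (D : K) • coords P := by
    have := F.coneJacobian_mulVec hv
    rw [Matrix.mulVec_smul, smul_comm] at this
    exact smul_right_injective _ hs this
  rw [Matrix.charpoly_eq_X_sub_C_mul_of_mulVec_eq_smul _ (coords_chart P) heig, multiplierPoly]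
  congr 2
  ext i j
  rw [Matrix.of_apply, coneJacobian_smul_apply, coneJacobian_smul_apply, jacobian, Matrix.of_apply,
    hFi i.1, eq_div_iff (pow_ne_zero 2 hF0)]
  -- With `F_i(u) = u_i F_b(u)` and `s^(D-1) F_b(u) = 1`, the quotient rule for `F_i / F_b` gives
  -- exactly `s^(D-1) (∂_j F_i - u_i ∂_j F_b)`.
  linear_combination (eval (coords P) (pderiv j.1 (F.poly i.1)) -
    coords P i.1 * eval (coords P) (pderiv j.1 (F.poly (chart P)))) *
      eval (coords P) (F.poly (chart P)) * hpow

/-- The origin is a simple fixed point of the cone map. -/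
theorem localMult_affIdeal_zero [IsAlgClosed K] [Finite ι] (hD : 2 ≤ D) :
    localMult F.affIdeal 0 = 1 := by
  rw [← localMult_pointIdeal (0 : ι → K)]
  have hsq (i : ι) : F.poly i ∈ pointIdeal (0 : ι → K) ^ 2 := by
    rw [pointIdeal_zero, mem_pow_idealOfVars_iff]
    intro x hx
    rwa [degree_eq_of_isHomogeneous (F.homogeneous i) hx]
  have hXm (i : ι) : (X i : MvPolynomial ι K) ∈ pointIdeal (0 : ι → K) := by
    simp [mem_pointIdeal]
  refine (localMult_eq_of_le ?_ ?_).symm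
  · rw [affIdeal, Ideal.span_le]
    rintro _ ⟨i, rfl⟩
    exact Ideal.sub_mem _ (Ideal.pow_le_self two_ne_zero (hsq i)) (hXm i)
  · have hle : pointIdeal (0 : ι → K) ≤
        F.affIdeal ⊔ pointIdeal (0 : ι → K) * pointIdeal (0 : ι → K) := by
      nth_rw 1 [pointIdeal_zero]
      rw [idealOfVars, Ideal.span_le]
      rintro _ ⟨i, rfl⟩
      rw [← sq, ← sub_sub_cancel (F.poly i) (X i)]
      exact Ideal.sub_mem _ (Ideal.mem_sup_right (hsq i))
        (Ideal.mem_sup_left (Ideal.subset_span ⟨i, rfl⟩))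
    have hloc := Ideal.map_mono (f := algebraMap (MvPolynomial ι K)
      (Localization.AtPrime (pointIdeal (0 : ι → K)))) hle
    rw [Ideal.map_sup, Ideal.map_mul] at hloc
    -- Nakayama: as `D ≥ 2`, each `F_i` lies in the square of the maximal ideal `m`, so `m` is
    -- contained in the ideal of the `F_i - x_i` plus `m^2`, and locally `m` is generated by the
    -- `F_i - x_i`.
    refine Submodule.le_of_le_smul_of_le_jacobson_bot
      (Ideal.FG.map ?_ _) ?_ hloc
    · rw [pointIdeal_zero]
      exact idealOfVars_fg ι K
    · rw [Localization.AtPrime.map_eq_maximalIdeal]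
      exact IsLocalRing.maximalIdeal_le_jacobson _

end ProjEndo

/-! ### Products of affine schemes and of cone maps. -/

/-- The ideal of the product of the schemes defined by `I` and `J`. -/
def prodIdeal (I : Ideal (MvPolynomial ι K)) (J : Ideal (MvPolynomial κ K)) :
    Ideal (MvPolynomial (ι ⊕ κ) K) :=
  I.map (rename Sum.inl : MvPolynomial ι K →ₐ[K] MvPolynomial (ι ⊕ κ) K) ⊔
    J.map (rename Sum.inr : MvPolynomial κ K →ₐ[K] MvPolynomial (ι ⊕ κ) K)

theorem rename_inl_mem_prodIdeal {I : Ideal (MvPolynomial ι K)} (J : Ideal (MvPolynomial κ K))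
    {p : MvPolynomial ι K} (hp : p ∈ I) : rename Sum.inl p ∈ prodIdeal I J :=
  Ideal.mem_sup_left (Ideal.mem_map_of_mem _ hp)

theorem rename_inr_mem_prodIdeal (I : Ideal (MvPolynomial ι K)) {J : Ideal (MvPolynomial κ K)}
    {p : MvPolynomial κ K} (hp : p ∈ J) : rename Sum.inr p ∈ prodIdeal I J :=
  Ideal.mem_sup_right (Ideal.mem_map_of_mem _ hp)

theorem prodIdeal_le_iff {I : Ideal (MvPolynomial ι K)} {J : Ideal (MvPolynomial κ K)}
    {L : Ideal (MvPolynomial (ι ⊕ κ) K)} :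
    prodIdeal I J ≤ L ↔ (∀ p ∈ I, rename Sum.inl p ∈ L) ∧ ∀ p ∈ J, rename Sum.inr p ∈ L := by
  rw [prodIdeal, sup_le_iff, Ideal.map_le_iff_le_comap, Ideal.map_le_iff_le_comap]
  rfl

theorem prodIdeal_mono {I I' : Ideal (MvPolynomial ι K)} {J J' : Ideal (MvPolynomial κ K)}
    (hI : I ≤ I') (hJ : J ≤ J') : prodIdeal I J ≤ prodIdeal I' J' :=
  sup_le_sup (Ideal.map_mono hI) (Ideal.map_mono hJ)

theorem mem_zeroLocus_prodIdeal {I : Ideal (MvPolynomial ι K)} {J : Ideal (MvPolynomial κ K)}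
    {z : ι ⊕ κ → K} : z ∈ zeroLocus K (prodIdeal I J) ↔
      z ∘ Sum.inl ∈ zeroLocus K I ∧ z ∘ Sum.inr ∈ zeroLocus K J := by
  have hz : z ∈ zeroLocus K (prodIdeal I J) ↔ prodIdeal I J ≤ RingHom.ker (eval z) :=
    mem_zeroLocus_iff_eval
  rw [hz, prodIdeal_le_iff, mem_zeroLocus_iff_eval, mem_zeroLocus_iff_eval]
  simp only [RingHom.mem_ker, eval_rename]

theorem finite_zeroLocus_prodIdeal {I : Ideal (MvPolynomial ι K)} {J : Ideal (MvPolynomial κ K)}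
    (hI : (zeroLocus K I).Finite) (hJ : (zeroLocus K J).Finite) :
    (zeroLocus K (prodIdeal I J)).Finite := by
  refine ((hI.prod hJ).image fun p => Sum.elim p.1 p.2).subset fun z hz => ?_
  exact ⟨(z ∘ Sum.inl, z ∘ Sum.inr), mem_zeroLocus_prodIdeal.mp hz, Sum.elim_comp_inl_inr z⟩

/-- The product map `θ : A ⊗ B → Q` is an isomorphism: polynomials surject onto both sides
compatibly, and the kernel towards `Q` lies in `prodIdeal`, which dies in `A ⊗ B`. -/
theorem finrank_eq_mul_of_ker_le_prodIdeal {A B Q : Type*} [CommRing A] [CommRing B] [CommRing Q]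
    [Algebra K A] [Algebra K B] [Algebra K Q] {f : MvPolynomial ι K →ₐ[K] A}
    {g : MvPolynomial κ K →ₐ[K] B} {q : MvPolynomial (ι ⊕ κ) K →ₐ[K] Q}
    (hf : Function.Surjective f) (hg : Function.Surjective g) (hq : Function.Surjective q)
    (θl : A →ₐ[K] Q) (hl : ∀ p, θl (f p) = q (rename Sum.inl p))
    (θr : B →ₐ[K] Q) (hr : ∀ p, θr (g p) = q (rename Sum.inr p))
    (hker : RingHom.ker q ≤ prodIdeal (RingHom.ker f) (RingHom.ker g)) :
    Module.finrank K Q = Module.finrank K A * Module.finrank K B := by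
  let φ : MvPolynomial (ι ⊕ κ) K →ₐ[K] A ⊗[K] B :=
    aeval (Sum.elim (fun i => f (X i) ⊗ₜ 1) fun j => 1 ⊗ₜ g (X j))
  have hφl (p : MvPolynomial ι K) : φ (rename Sum.inl p) = f p ⊗ₜ 1 := by
    have : φ.comp (rename Sum.inl) =
        (Algebra.TensorProduct.includeLeft : _ →ₐ[K] A ⊗[K] B).comp f :=
      MvPolynomial.algHom_ext fun i => by simp [φ]
    exact DFunLike.congr_fun this p
  have hφr (p : MvPolynomial κ K) : φ (rename Sum.inr p) = 1 ⊗ₜ g p := by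
    have : φ.comp (rename Sum.inr) =
        (Algebra.TensorProduct.includeRight : _ →ₐ[K] A ⊗[K] B).comp g :=
      MvPolynomial.algHom_ext fun i => by simp [φ]
    exact DFunLike.congr_fun this p
  have hφker : prodIdeal (RingHom.ker f) (RingHom.ker g) ≤ RingHom.ker φ := by
    rw [prodIdeal_le_iff]
    refine ⟨fun p hp => ?_, fun p hp => ?_⟩
    · rw [RingHom.mem_ker, hφl, RingHom.mem_ker.mp hp, TensorProduct.zero_tmul]
    · rw [RingHom.mem_ker, hφr, RingHom.mem_ker.mp hp, TensorProduct.tmul_zero]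
  have hφsurj : Function.Surjective φ := fun t => by
    induction t using TensorProduct.induction_on with
    | zero => exact ⟨0, map_zero _⟩
    | add s t hs ht =>
      obtain ⟨p, rfl⟩ := hs
      obtain ⟨p', rfl⟩ := ht
      exact ⟨p + p', map_add _ _ _⟩
    | tmul a b =>
      obtain ⟨p, rfl⟩ := hf a
      obtain ⟨p', rfl⟩ := hg b
      refine ⟨rename Sum.inl p * rename Sum.inr p', ?_⟩
      rw [map_mul, hφl, hφr, Algebra.TensorProduct.tmul_mul_tmul, mul_one, one_mul]
  let θ := Algebra.TensorProduct.productMap θl θr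
  have hθφ (p : MvPolynomial (ι ⊕ κ) K) : θ (φ p) = q p := by
    have : θ.comp φ = q := by
      refine MvPolynomial.algHom_ext fun k => ?_
      rw [AlgHom.comp_apply]
      rcases k with i | j
      · rw [← rename_X Sum.inl i, hφl, Algebra.TensorProduct.productMap_apply_tmul, map_one,
          mul_one, hl]
      · rw [← rename_X Sum.inr j, hφr, Algebra.TensorProduct.productMap_apply_tmul, map_one,
          one_mul, hr]
    exact DFunLike.congr_fun this p
  have hbij : Function.Bijective θ := by
    refine ⟨(injective_iff_map_eq_zero θ).mpr fun t ht => ?_, fun y => ?_⟩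
    · obtain ⟨p, rfl⟩ := hφsurj t
      rw [hθφ] at ht
      exact hφker (hker ht)
    · obtain ⟨p, rfl⟩ := hq y
      exact ⟨φ p, hθφ p⟩
  rw [← (LinearEquiv.ofBijective θ.toLinearMap hbij).finrank_eq, Module.finrank_tensorProduct]

/-- The coordinate ring of a product is the tensor product of the coordinate rings. -/
theorem finrank_quotient_prodIdeal (I : Ideal (MvPolynomial ι K)) (J : Ideal (MvPolynomial κ K)) :
    Module.finrank K (MvPolynomial (ι ⊕ κ) K ⧸ prodIdeal I J) =
      Module.finrank K (MvPolynomial ι K ⧸ I) * Module.finrank K (MvPolynomial κ K ⧸ J) := by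
  refine finrank_eq_mul_of_ker_le_prodIdeal (Ideal.Quotient.mkₐ_surjective K I)
    (Ideal.Quotient.mkₐ_surjective K J) (Ideal.Quotient.mkₐ_surjective K (prodIdeal I J))
    (Ideal.Quotient.liftₐ I ((Ideal.Quotient.mkₐ K _).comp (rename Sum.inl)) fun p hp =>
      Ideal.Quotient.eq_zero_iff_mem.mpr (rename_inl_mem_prodIdeal J hp)) (fun p => rfl)
    (Ideal.Quotient.liftₐ J ((Ideal.Quotient.mkₐ K _).comp (rename Sum.inr)) fun p hp =>
      Ideal.Quotient.eq_zero_iff_mem.mpr (rename_inr_mem_prodIdeal I hp)) (fun p => rfl) ?_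
  exact (Ideal.Quotient.mkₐ_ker K (prodIdeal I J)).le.trans
    (prodIdeal_mono (Ideal.Quotient.mkₐ_ker K I).ge (Ideal.Quotient.mkₐ_ker K J).ge)

/-- Idempotents reduce both factors to one-point schemes, where the multiplicity is the dimension of
the coordinate ring and dimensions multiply under tensor products. -/
theorem localMult_prodIdeal [IsAlgClosed K] [Finite ι] [Finite κ] {I : Ideal (MvPolynomial ι K)}
    {J : Ideal (MvPolynomial κ K)} (hI : (zeroLocus K I).Finite) (hJ : (zeroLocus K J).Finite)
    {v : ι → K} {w : κ → K} (hv : v ∈ zeroLocus K I) (hw : w ∈ zeroLocus K J) :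
    localMult (prodIdeal I J) (Sum.elim v w) = localMult I v * localMult J w := by
  classical
  obtain ⟨e, he, hev⟩ := exists_idempotent hI {v}
  obtain ⟨e', he', hev'⟩ := exists_idempotent hJ {w}
  have hmult := finrank_quotient_sup_span_one_sub hI he hev
  rw [Finset.sum_eq_single v (by simp +contextual) (by simp_all)] at hmult
  have hmult' := finrank_quotient_sup_span_one_sub hJ he' hev'
  rw [Finset.sum_eq_single w (by simp +contextual) (by simp_all)] at hmult'
  rw [← hmult, ← hmult', ← finrank_quotient_prodIdeal]
  set I' := I ⊔ Ideal.span {1 - e} with hI'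
  set J' := J ⊔ Ideal.span {1 - e'} with hJ'
  have hfin : (zeroLocus K (prodIdeal I' J')).Finite :=
    (finite_zeroLocus_prodIdeal hI hJ).subset
      (zeroLocus_anti_mono (prodIdeal_mono le_sup_left le_sup_left))
  have hzero : hfin.toFinset = {Sum.elim v w} := by
    ext z
    rw [Set.Finite.mem_toFinset, Finset.mem_singleton, mem_zeroLocus_prodIdeal,
      mem_zeroLocus_sup_span_one_sub_iff hev, mem_zeroLocus_sup_span_one_sub_iff hev']
    constructor
    · rintro ⟨⟨_, h1⟩, _, h2⟩
      rw [← Sum.elim_comp_inl_inr z, h1, h2]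
    · rintro rfl
      exact ⟨⟨hv, rfl⟩, hw, rfl⟩
  rw [finrank_quotient_eq_sum_localMult hfin, hzero, Finset.sum_singleton]
  refine (localMult_eq_of_le (prodIdeal_mono le_sup_left le_sup_left) ?_).symm
  rw [Ideal.map_le_iff_le_comap, prodIdeal_le_iff]
  have hle : prodIdeal I J ≤ ((prodIdeal I J).map (algebraMap (MvPolynomial (ι ⊕ κ) K)
      (Localization.AtPrime (ProjEndo.pointIdeal (Sum.elim v w))))).comap
        (algebraMap (MvPolynomial (ι ⊕ κ) K) _) := Ideal.le_comap_map
  constructor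
  · intro p hp
    obtain ⟨a, ha, q, hq, rfl⟩ := Submodule.mem_sup.mp hp
    obtain ⟨q, rfl⟩ := Ideal.mem_span_singleton.mp hq
    rw [map_add, map_mul, map_sub, map_one]
    refine Ideal.add_mem _ (hle (rename_inl_mem_prodIdeal J ha)) (Ideal.mul_mem_right _ _ ?_)
    refine one_sub_mem_map_of_idempotent ?_ ?_
    · simpa using rename_inl_mem_prodIdeal J he
    · rw [eval_rename, Sum.elim_comp_inl, (hev v hv).1 rfl]
      exact one_ne_zero
  · intro p hp
    obtain ⟨a, ha, q, hq, rfl⟩ := Submodule.mem_sup.mp hp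
    obtain ⟨q, rfl⟩ := Ideal.mem_span_singleton.mp hq
    rw [map_add, map_mul, map_sub, map_one]
    refine Ideal.add_mem _ (hle (rename_inr_mem_prodIdeal I ha)) (Ideal.mul_mem_right _ _ ?_)
    refine one_sub_mem_map_of_idempotent ?_ ?_
    · simpa using rename_inr_mem_prodIdeal I he'
    · rw [eval_rename, Sum.elim_comp_inr, (hev' w hw).1 rfl]
      exact one_ne_zero

namespace ProjEndo

variable {D : ℕ} (F : ProjEndo K ι D) (G : ProjEndo K κ D)

/-- The equations `F(x) = x` and `G(y) = y` separate the variables; the projective fixed point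
equations do not. -/
theorem affIdeal_prod : (F.prod G).affIdeal = prodIdeal F.affIdeal G.affIdeal := by
  rw [affIdeal, affIdeal, affIdeal, prodIdeal, Ideal.map_span, Ideal.map_span, ← Ideal.span_union,
    ← Set.range_comp, ← Set.range_comp, ← Set.Sum.elim_range]
  congr 2
  ext1 k
  rcases k with i | j <;> simp [prod]

theorem coneJacobian_prod (v : ι → K) (w : κ → K) :
    (F.prod G).coneJacobian (Sum.elim v w) =
      Matrix.fromBlocks (F.coneJacobian v) 0 0 (G.coneJacobian w) := by
  classical
  have h1 (j : κ) (p : MvPolynomial ι K) : pderiv (Sum.inr j) (rename (Sum.inl : ι → ι ⊕ κ) p) = 0 :=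
    pderiv_eq_zero_of_notMem_vars fun h => by simpa using vars_rename _ p h
  have h2 (i : ι) (p : MvPolynomial κ K) : pderiv (Sum.inl i) (rename (Sum.inr : κ → ι ⊕ κ) p) = 0 :=
    pderiv_eq_zero_of_notMem_vars fun h => by simpa using vars_rename _ p h
  ext k l
  rcases k with i | i <;> rcases l with j | j <;>
    simp [coneJacobian, prod, pderiv_rename Sum.inl_injective, pderiv_rename Sum.inr_injective,
      eval_rename, h1, h2]

theorem iter_prod (n : ℕ) : (F.prod G).iter n = (F.iter n).prod (G.iter n) := by
  have h : (F.prod G).iterPoly n = ((F.iter n).prod (G.iter n)).poly := by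
    induction n with
    | zero => ext1 k; rcases k with i | j <;> simp [iterPoly, prod, iter]
    | succ n ih =>
      have hs (H : ProjEndo K (ι ⊕ κ) D) (k : ι ⊕ κ) :
          H.iterPoly (n + 1) k = bind₁ (H.iterPoly n) (H.poly k) := rfl
      ext1 k
      rw [hs, ih]
      rcases k with i | j <;>
        simp only [prod, iter, iterPoly, Sum.elim_inl, Sum.elim_inr, bind₁_rename,
          rename_bind₁] <;> rfl
  unfold iter prod
  congr 1

end ProjEndo

/-! ### Spectra as formal sums over the multiplicative monoid `K[t]`. -/

theorem single_one_mul_injective {R : Type*} [CommRing R] [IsDomain R] {a : R} (ha : a ≠ 0) :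
    Function.Injective fun x : MonoidAlgebra ℕ R => MonoidAlgebra.single a 1 * x := by
  intro x y h
  ext m
  have := DFunLike.congr_fun (congrArg MonoidAlgebra.coeff h) (a * m)
  -- Multiplication by `a ≠ 0` is injective on the monoid, so only `m` contributes to the
  -- coefficient at `a * m`.
  have hx (z : MonoidAlgebra ℕ R) : (MonoidAlgebra.single a 1 * z).coeff (a * m) = z.coeff m := by
    rw [z.coeff_single_mul_eq_mul_coeff m fun m' _ => mul_right_inj' ha, one_mul]
  rwa [hx, hx] at this

namespace ProjEndo

variable {D d : ℕ} (F : ProjEndo K ι D) (G : ProjEndo K κ D)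

theorem zero_mem_zeroLocus_affIdeal (hD : 2 ≤ D) : (0 : ι → K) ∈ zeroLocus K F.affIdeal := by
  rw [mem_zeroLocus_affIdeal]
  intro i
  rw [← zero_smul K (0 : ι → K), eval_smul_of_isHomogeneous (F.homogeneous i),
    zero_pow (by omega), zero_mul]
  simp

variable [Fintype ι] [DecidableEq ι] [Fintype κ] [DecidableEq κ]

/-- The formal sum of the characteristic polynomials of the Jacobian matrices of the cone map at its
fixed vectors, counted with multiplicity. -/
def coneSpectrum [IsAlgClosed K] (hD : 2 ≤ D) : MonoidAlgebra ℕ (Polynomial K) :=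
  ∑ v ∈ (F.finite_zeroLocus_affIdeal hD).toFinset,
    MonoidAlgebra.single (F.coneJacobian v).charpoly (localMult F.affIdeal v)

/-- The formal sum of the multiplier polynomials of the fixed points, counted with multiplicity. -/
def spectrum [IsAlgClosed K] (hD : 2 ≤ D) : MonoidAlgebra ℕ (Polynomial K) :=
  ∑ P ∈ (F.finite_fixedPoints hD).toFinset,
    MonoidAlgebra.single (F.multiplierPoly P) (F.fixedMult P)

theorem coneSpectrum_eq [IsAlgClosed K] (hD : 2 ≤ D) :
    F.coneSpectrum hD = MonoidAlgebra.single (Polynomial.X ^ Fintype.card ι) 1 + (D - 1) •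
      (MonoidAlgebra.single (Polynomial.X - Polynomial.C (D : K)) 1 * F.spectrum hD) := by
  classical
  set V := (F.finite_zeroLocus_affIdeal hD).toFinset with hV
  have hmemV {v : ι → K} : v ∈ V ↔ v ∈ zeroLocus K F.affIdeal := Set.Finite.mem_toFinset _
  -- Nonzero fixed vectors are partitioned by the projective point they represent.
  have hunion : V.erase 0 = (F.finite_fixedPoints hD).toFinset.biUnion fun P =>
      {v ∈ V | ∃ s : K, s ≠ 0 ∧ v = s • coords P} := by
    ext v
    rw [Finset.mem_erase, Finset.mem_biUnion]
    constructor
    · rintro ⟨hv, hvV⟩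
      refine ⟨Projectivization.mk K v hv, ?_, Finset.mem_filter.mpr ⟨hvV,
        (mk_eq_iff_exists_smul_coords hv _).mp rfl⟩⟩
      rw [Set.Finite.mem_toFinset]
      exact F.mk_mem_fixedPoints hv (hmemV.mp hvV)
    · rintro ⟨P, -, hP⟩
      obtain ⟨hvV, s, hs, rfl⟩ := Finset.mem_filter.mp hP
      exact ⟨smul_ne_zero hs (coords_ne_zero P), hvV⟩
  have hdisj : ((F.finite_fixedPoints hD).toFinset : Set (ℙ K (ι → K))).PairwiseDisjoint fun P =>
      {v ∈ V | ∃ s : K, s ≠ 0 ∧ v = s • coords P} := by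
    intro P _ Q _ hPQ
    rw [Function.onFun, Finset.disjoint_left]
    intro v hvP hvQ
    obtain ⟨s, hs, hv⟩ := (Finset.mem_filter.mp hvP).2
    have hv0 : v ≠ 0 := hv ▸ smul_ne_zero hs (coords_ne_zero P)
    exact hPQ (((mk_eq_iff_exists_smul_coords hv0 P).mpr ⟨s, hs, hv⟩).symm.trans
      ((mk_eq_iff_exists_smul_coords hv0 Q).mpr (Finset.mem_filter.mp hvQ).2))
  rw [coneSpectrum, ← hV, ← Finset.add_sum_erase V _ (hmemV.mpr (F.zero_mem_zeroLocus_affIdeal hD)),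
    F.coneJacobian_zero hD, Matrix.charpoly_zero, F.localMult_affIdeal_zero hD, hunion,
    Finset.sum_biUnion hdisj, spectrum, Finset.mul_sum, Finset.smul_sum]
  congr 1
  refine Finset.sum_congr rfl fun P hP => ?_
  rw [Set.Finite.mem_toFinset] at hP
  rw [MonoidAlgebra.single_mul_single, one_mul, MonoidAlgebra.smul_single, smul_eq_mul,
    ← F.sum_localMult_affIdeal hD hP]
  have hsum (s : Finset (ι → K)) (m : (ι → K) → ℕ) (a : Polynomial K) :
      MonoidAlgebra.single a (∑ v ∈ s, m v) = ∑ v ∈ s, MonoidAlgebra.single a (m v) :=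
    map_sum (MonoidAlgebra.singleAddHom a) _ _
  rw [hsum]
  refine Finset.sum_congr rfl fun v hv => ?_
  obtain ⟨hvV, s, hs, rfl⟩ := Finset.mem_filter.mp hv
  rw [F.charpoly_coneJacobian hD hs (hmemV.mp hvV)]

/-- Fixed vectors of the product are pairs of fixed vectors, multiplicities multiply, and the block
diagonal Jacobian has the product characteristic polynomial. -/
theorem coneSpectrum_prod [IsAlgClosed K] (hD : 2 ≤ D) :
    (F.prod G).coneSpectrum hD = F.coneSpectrum hD * G.coneSpectrum hD := by
  rw [coneSpectrum, coneSpectrum, coneSpectrum, Finset.sum_mul_sum, ← Finset.sum_product']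
  refine Finset.sum_nbij' (fun z => (z ∘ Sum.inl, z ∘ Sum.inr)) (fun p => Sum.elim p.1 p.2)
    ?_ ?_ ?_ ?_ ?_
  · intro z hz
    rw [Set.Finite.mem_toFinset, affIdeal_prod, mem_zeroLocus_prodIdeal] at hz
    rwa [Finset.mem_product, Set.Finite.mem_toFinset, Set.Finite.mem_toFinset]
  · intro p hp
    rw [Finset.mem_product, Set.Finite.mem_toFinset, Set.Finite.mem_toFinset] at hp
    rwa [Set.Finite.mem_toFinset, affIdeal_prod, mem_zeroLocus_prodIdeal]
  · intro z _
    exact Sum.elim_comp_inl_inr z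
  · intro p _
    rfl
  · intro z hz
    rw [Set.Finite.mem_toFinset, affIdeal_prod, mem_zeroLocus_prodIdeal] at hz
    obtain ⟨v, w, rfl⟩ : ∃ v w, z = Sum.elim v w := ⟨_, _, (Sum.elim_comp_inl_inr z).symm⟩
    rw [Sum.elim_comp_inl, Sum.elim_comp_inr] at hz ⊢
    rw [coneJacobian_prod, Matrix.charpoly_fromBlocks_zero₁₂, affIdeal_prod,
      localMult_prodIdeal (F.finite_zeroLocus_affIdeal hD) (G.finite_zeroLocus_affIdeal hD) hz.1 hz.2,
      MonoidAlgebra.single_mul_single]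

theorem coneSpectrum_eq_iff [IsAlgClosed K] (hD : 2 ≤ D) {F F' : ProjEndo K ι D} :
    F.coneSpectrum hD = F'.coneSpectrum hD ↔ F.spectrum hD = F'.spectrum hD := by
  rw [coneSpectrum_eq, coneSpectrum_eq]
  refine ⟨fun h => ?_, fun h => by rw [h]⟩
  have h1 := add_left_cancel h
  refine single_one_mul_injective (Polynomial.X_sub_C_ne_zero (D : K)) ?_
  ext m
  have := DFunLike.congr_fun (congrArg MonoidAlgebra.coeff h1) m
  rw [MonoidAlgebra.coeff_smul_apply, MonoidAlgebra.coeff_smul_apply, smul_eq_mul,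
    smul_eq_mul] at this
  -- Coefficients are natural numbers, so `D - 1 ≥ 1` cancels whatever the characteristic of `K`.
  exact Nat.eq_of_mul_eq_mul_left (by omega) this

/-! ### From the multiplier invariants to the spectrum. -/

variable (f : ProjEndo K ι d)

theorem sigmaPoly_eq [IsAlgClosed K] {n : ℕ} (hD : 2 ≤ d ^ n) :
    f.sigmaPoly n = ((Finsupp.toMultiset ((f.iter n).spectrum hD).coeff).map
      fun p => Polynomial.X - Polynomial.C p).prod := by
  rw [sigmaPoly, finprod_mem_eq_finite_toFinset_prod _ ((f.iter n).finite_fixedPoints hD), spectrum,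
    MonoidAlgebra.coeff_sum, map_sum, ← Multiset.coe_mapAddMonoidHom, map_sum, Multiset.prod_sum]
  refine Finset.prod_congr rfl fun P _ => ?_
  rw [MonoidAlgebra.coeff_single, Finsupp.toMultiset_single, map_nsmul, Multiset.prod_nsmul]
  simp

/-- `Σ_n` splits into linear factors in `w` over the domain `K[t]`, so its roots recover the
multipliers with multiplicity. -/
theorem sigmaPoly_eq_iff [IsAlgClosed K] {n : ℕ} (hD : 2 ≤ d ^ n) {f f' : ProjEndo K ι d} :
    f.sigmaPoly n = f'.sigmaPoly n ↔ (f.iter n).spectrum hD = (f'.iter n).spectrum hD := by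
  rw [sigmaPoly_eq f hD, sigmaPoly_eq f' hD]
  refine ⟨fun h => ?_, fun h => by rw [h]⟩
  have := congrArg Polynomial.roots h
  rw [Polynomial.roots_multiset_prod_X_sub_C, Polynomial.roots_multiset_prod_X_sub_C] at this
  classical
  refine MonoidAlgebra.coeff_injective ?_
  rw [← Finsupp.toMultiset_toFinsupp ((f.iter n).spectrum hD).coeff, this,
    Finsupp.toMultiset_toFinsupp]

theorem sigma_eq_iff {n : ℕ} {f f' : ProjEndo K ι d} :
    f.sigma n = f'.sigma n ↔ f.sigmaPoly n = f'.sigmaPoly n := by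
  constructor
  · intro h
    ext k l
    -- Solving `k = D_n - i` and `l = N i - j` for the integer labels reaches the coefficient of
    -- `w^k t^l` for all `k` and `l`.
    have := congrFun₂ h ((numPer ι d n : ℤ) - k)
      (((Fintype.card ι : ℤ) - 1) * ((numPer ι d n : ℤ) - k) - l)
    rw [sigma, sigma, sub_sub_cancel, sub_sub_cancel, if_pos ⟨by positivity, by positivity⟩,
      if_pos ⟨by positivity, by positivity⟩, Int.toNat_natCast, Int.toNat_natCast] at this
    exact mul_left_cancel₀ (zpow_ne_zero _ (neg_ne_zero.mpr one_ne_zero)) this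
  · intro h
    funext i j
    rw [sigma, sigma, h]

theorem isIsospectral_iff {A : Type*} {f : A → ProjEndo K ι d} :
    IsIsospectral f ↔ ∀ n, 1 ≤ n → ∀ a a', (f a).sigma n = (f a').sigma n := by
  constructor
  · intro h n hn a a'
    have := congrFun (h n a a') ⟨n - 1, by omega⟩
    simpa only [tau, Nat.sub_add_cancel hn] using this
  · intro h n a a'
    funext k
    exact h _ (Nat.le_add_left 1 _) a a'

end ProjEndo

end

theorem mainTheorem3 {K : Type*} [Field K] [IsAlgClosed K] (N M d : ℕ) (hd : 2 ≤ d)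
    {A B : Type*} (f : A → ProjEndo K (Fin (N + 1)) d) (g : B → ProjEndo K (Fin (M + 1)) d)
    (hf : ProjEndo.IsIsospectral f) (hg : ProjEndo.IsIsospectral g) :
    ProjEndo.IsIsospectral (fun p : A × B => (f p.1).prod (g p.2)) := by
  rw [ProjEndo.isIsospectral_iff] at hf hg ⊢
  intro n hn p p'
  have hD : 2 ≤ d ^ n := hd.trans (Nat.le_self_pow (by omega) d)
  have hf' := hf n hn p.1 p'.1
  have hg' := hg n hn p.2 p'.2
  rw [ProjEndo.sigma_eq_iff, ProjEndo.sigmaPoly_eq_iff hD, ← ProjEndo.coneSpectrum_eq_iff]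
    at hf' hg' ⊢
  rw [ProjEndo.iter_prod, ProjEndo.iter_prod, ProjEndo.coneSpectrum_prod,
    ProjEndo.coneSpectrum_prod, hf', hg']
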